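/- **Setting.** Let $n,m\ge 1$. Write $|\cdot|$ for the Euclidean norm on $\mathbb R^{n\times n}$, $\operatorname{Per}$ for the (De Giorgi) perimeter, and $K^{lc}=\bigcup_{l\ge0}R_l(K)$ for the lamination convex hull of $K\subset\mathbb R^{n\times n}$, where $R_0(K)=K$ and $R_{l}(K)$ consists of $R_{l-1}(K)$ and of all $\lambda A+(1-\lambda)B$ with $\lambda\in(0,1)$, $A,B\in R_{l-1}(K)$, $\operatorname{rank}(A-B)=1$. Interiors and openness in matrix space are understood relative to a fixed ambient set $\mathcal A\supset K^{lc}$ (for instance $\mathbb R^{n\times n}$, or the trace-free matrices). A sequence of open sets $W_i$ is an *in-approximation* of $K$ if $W_i\subset W_{i+1}^{lc}$, and if $V_i\in W_i$ for all large $i$ and $V_i\to V$ imply $V\in K$. Let $\mathcal C$ be a class of bounded open subsets of $\mathbb R^n$ of finite perimeter. Given $D\in\mathcal C$, $M\in\mathbb R^{n\times n}$, $v_1\in(0,1)$ and a set $V$ of matrices, a *replacement* of $Mx$ on $D$ with values in $V$ is a continuous $u:\overline D\to\mathbb R^n$ such that $D$ is, up to a null set, the disjoint union of finitely many $D_1,\dots,D_N\in\mathcal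 C$, $u$ is affine on each $D_i$, and for some subfamily of the $D_i$, with union $D_g$: $u(x)=Mx$ on $\partial D$ and on every $D_i\not\subset D_g$; $\nabla u\in V$ in $D_g$; and $|D_g|\ge v_1|D|$. **Assumptions.** There are constants $C_1,C_2\ge1$, $v_1,c_2\in(0,1)$, $C_0(j,k)\ge 1$ and $C_3(M)>1$ such that the following hold. (A1) A group $G$ acts on $K^{lc}$, and $K$ is the disjoint union of finitely many orbits $GM_1,\dots,GM_N$ with pairwise distances at least some $c_1>0$; the (relative) interior $\operatorname{int}(K^{lc})$ is nonempty. (A2) There are $G$-invariant sets $\tilde U_k^j,U_k^j\subset\operatorname{int}(K^{lc})$ ($k\in\mathbb N$, $0\le j\le m$) with $\operatorname{int}(K^{lc})=\bigcup_{k,j}\tilde U_k^j$ and $\tilde U_k^m=U_k^m=U_{k+1}^0$, such that for every $k$ the sequence $\tilde U_k^0,\dots,\tilde U_k^m=U_{k+1}^0,U_{k+1}^1,\dots,U_{k+1}^m=U_{k+2}^0,\dots$ is an in-approximation of $K$, and such that $\sup_{M\in U_k^j}\operatorname{dist}(M,K)\to0$ as $k\to\infty$ for every $j$. For all $k_0$,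 $j_0\le m$ and $M_0\in\tilde U_{k_0}^{j_0}$ there are subfamilies $\tilde V_k^j\subset\tilde U_k^j$, $V_k^j\subset U_k^j$ with $M_0\in\tilde V_{k_0}^{j_0}$ and $\tilde V_k^m=V_k^m=V_{k+1}^0$ (one may take $\tilde V=\tilde U$, $V=U$ if the constructions there have uniformly bounded gradients) such that, with $C_3=C_3(M_0)$: (A3~) for all $k$, $j<m$, $M\in\tilde V_k^j$ and $D\in\mathcal C$ there is a replacement of $Mx$ on $D$ with values in $\tilde V_k^{j+1}$ such that the pieces in $D_g$ satisfy $\sum\operatorname{Per}(D_i)\le C_0(j,k)\operatorname{Per}(D)$. Moreover, for a special class $\mathcal C^1=\mathcal C^1_{k,j,M}\subset\mathcal C$: if $D\in\mathcal C^1$, then the pieces outside $D_g$ belong to $\mathcal C^1$ and their perimeters sum to at most $C_2\operatorname{Per}(D)$; if $D\notin\mathcal C^1$, then the pieces outside $D_g$ split into two groups, the first consisting of elements of $\mathcal C^1$ with perimeter sum at most $C_0(j,k)\operatorname{Per}(D)$, the second with perimeter sum at most $C_2\operatorname{Per}(D)$. (A3) for all $k$, $j<m$, $M\in V_k^j$ and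 $D\in\mathcal C$ there is a replacement of $Mx$ on $D$ with values in $V_k^{j+1}$ such that $\sum_{i=1}^N\operatorname{Per}(D_i)\le C_1\operatorname{Per}(D)$. (A4) In (A3) there is a measurable $D_g^\star\subset D_g$ with $|D_g^\star|\ge(1-C_3c_2^k)|D_g|$ and $|\nabla u-M|\le C_3c_2^k$ in $D_g^\star$; in both (A3~) and (A3), $|\nabla u|\le C_3$ in $D$. **Theorem.** There is $\theta_0\in(0,1)$ depending only on $n,m,C_1,C_2,v_1,c_2$ such that, whenever these assumptions hold, for all $s\in(0,1)$, $p\in(1,\infty)$ with $0<sp<\theta_0$, all $\Omega\in\mathcal C$ and all $M_0\in\operatorname{int}(K^{lc})$ there is $u\in W^{1,\infty}_{loc}(\mathbb R^n;\mathbb R^n)$ with $$\nabla u\in K\ \text{ a.e. in }\Omega,\qquad \nabla u=M_0\ \text{ a.e. in }\mathbb R^n\setminus\Omega,\qquad \nabla u\in W^{s,p}_{loc}(\mathbb R^n),$$ and $\|\nabla u\|_{W^{s,p}(\Omega)}\le C$. Here $C>1$ depends only on $n,m,s,p,\Omega,C_1,C_2,v_1,c_2$, on $C_3(M_0)$ and,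 for any $k$ with $M_0\in\bigcup_{j\le m}\tilde U^j_k$, on an upper bound for $C_0(j,k)$, $j<m$. -/

import Mathlib

open MeasureTheory Set Filter Topology
open scoped ENNReal ContDiff

noncomputable section

/-- Euclidean space `ℝⁿ`. -/
abbrev Vec (n : ℕ) : Type := EuclideanSpace ℝ (Fin n)

/-- Real `n × n` matrices (with their usual topology). -/
abbrev Mat (n : ℕ) : Type := Matrix (Fin n) (Fin n) ℝ

/-- The Euclidean (Frobenius) norm `|A|` of a matrix. -/
def matNorm {n : ℕ} (A : Mat n) : ℝ := Real.sqrt (∑ i, ∑ j, A i j ^ 2)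

/-- The linear map `x ↦ M x` on `ℝⁿ`. -/
def matApply {n : ℕ} (M : Mat n) (x : Vec n) : Vec n := Matrix.toEuclideanLin M x

/-! ### Lamination convexity, relative interior, in-approximations -/

/-- Laminates of order at most `l` of the set `K`. -/
def laminates {n : ℕ} (K : Set (Mat n)) : ℕ → Set (Mat n)
  | 0 => K
  | l + 1 => laminates K l ∪
      {M | ∃ A ∈ laminates K l, ∃ B ∈ laminates K l, ∃ t : ℝ, 0 < t ∧ t < 1 ∧
        (A - B).rank = 1 ∧ M = t • A + (1 - t) • B}

/-- The lamination convex hull `K^{lc}`. -/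
def lamHull {n : ℕ} (K : Set (Mat n)) : Set (Mat n) := ⋃ l, laminates K l

/-- Interior of `S` relative to an ambient constraint set `A` of matrices (`A = univ` gives the
usual interior; `A = {tr = 0}` is the interior under a trace constraint). -/
def relInt {n : ℕ} (A S : Set (Mat n)) : Set (Mat n) := {M | M ∈ S ∧ S ∈ 𝓝[A] M}

/-- `W` is an in-approximation of `K`, with openness understood relative to `A`. In the second
condition finitely many members of the sequence are disregarded, so that an empty initial set does
not make the condition void; for nonempty sets this is the usual condition. -/
structure IsInApproximation {n : ℕ} (A K : Set (Mat n)) (W : ℕ → Set (Mat n)) : Prop where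
  isOpen : ∀ i, ∃ O : Set (Mat n), IsOpen O ∧ W i = O ∩ A
  subset : ∀ i, W i ⊆ lamHull (W (i + 1))
  limit : ∀ (V : ℕ → Mat n) (V' : Mat n),
    (∀ᶠ i in atTop, V i ∈ W i) → Tendsto V atTop (𝓝 V') → V' ∈ K

/-- The sequence
`Ũ_k^0, …, Ũ_k^m = U_{k+1}^0, U_{k+1}^1, …, U_{k+1}^m = U_{k+2}^0, U_{k+2}^1, …`. -/
def chain {n : ℕ} (m : ℕ) (Ut U : ℕ → ℕ → Set (Mat n)) (k : ℕ) : ℕ → Set (Mat n) :=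
  fun i => if i < m then Ut k i else U (k + i / m) (i % m)

/-! ### Perimeter, piecewise affine replacement constructions -/

/-- The divergence of a vector field. -/
def divergence {n : ℕ} (φ : Vec n → Vec n) (x : Vec n) : ℝ :=
  ∑ i, (fderiv ℝ φ x (EuclideanSpace.single i 1)) i

/-- The (De Giorgi) perimeter of a set. -/
def perimeter {n : ℕ} (D : Set (Vec n)) : ℝ≥0∞ :=
  ⨆ (φ : Vec n → Vec n) (_ : ContDiff ℝ 1 φ ∧ HasCompactSupport φ ∧ ∀ x, ‖φ x‖ ≤ 1),
    ENNReal.ofReal (∫ x in D, divergence φ x)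

/-- A class of bounded open sets of finite perimeter. -/
def IsDomainClass {n : ℕ} (𝒞 : Set (Set (Vec n))) : Prop :=
  ∀ D ∈ 𝒞, IsOpen D ∧ Bornology.IsBounded D ∧ perimeter D ≠ ⊤

/-- A replacement of the affine map `x ↦ M x` on `D` by a continuous piecewise affine map `u`.
The domain `D` is, up to a null set, the disjoint union of finitely many pieces from the class `𝒞`,
on each of which `∇u` is constant (so each level set of `∇u` is, up to a null set, a finite union
of pieces). `D_g` is the union of the pieces with index in `good`. -/
structure Replacement {n : ℕ} (𝒞 : Set (Set (Vec n))) (V : Set (Mat n)) (v₁ C₃ : ℝ)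
    (M : Mat n) (D : Set (Vec n)) where
  /-- the map -/
  u : Vec n → Vec n
  /-- the number of pieces -/
  N : ℕ
  /-- the pieces -/
  piece : Fin N → Set (Vec n)
  /-- the value of `∇u` on a piece -/
  grad : Fin N → Mat n
  /-- the constant part of `u` on a piece -/
  shift : Fin N → Vec n
  /-- the indices of the pieces that make up `D_g` -/
  good : Finset (Fin N)
  continuousOn : ContinuousOn u (closure D)
  piece_mem : ∀ i, piece i ∈ 𝒞
  piece_subset : ∀ i, piece i ⊆ D
  disjoint : ∀ i j, i ≠ j → Disjoint (piece i) (piece j)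
  cover : volume (D \ ⋃ i, piece i) = 0
  affine : ∀ i, ∀ x ∈ piece i, u x = matApply (grad i) x + shift i
  boundary : ∀ x ∈ frontier D, u x = matApply M x
  bad_eq : ∀ i ∉ good, ∀ x ∈ piece i, u x = matApply M x
  good_grad : ∀ i ∈ good, grad i ∈ V
  good_volume : ENNReal.ofReal v₁ * volume D ≤ ∑ i ∈ good, volume (piece i)
  grad_bound : ∀ i, matNorm (grad i) ≤ C₃

/-- Perimeter bounds for a replacement in the first phase. `𝒞₁` is the special (self-similar)
class, `c₀` the nonuniform constant and `C₂` the uniform one. -/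
def FirstPhaseBounds {n : ℕ} {𝒞 : Set (Set (Vec n))} {V : Set (Mat n)} {v₁ C₃ : ℝ}
    {M : Mat n} {D : Set (Vec n)} (r : Replacement 𝒞 V v₁ C₃ M D)
    (𝒞₁ : Set (Set (Vec n))) (c₀ C₂ : ℝ) : Prop :=
  (∑ i ∈ r.good, perimeter (r.piece i) ≤ ENNReal.ofReal c₀ * perimeter D) ∧
  (D ∈ 𝒞₁ →
    (∀ i ∉ r.good, r.piece i ∈ 𝒞₁) ∧
    ∑ i ∈ r.goodᶜ, perimeter (r.piece i) ≤ ENNReal.ofReal C₂ * perimeter D) ∧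
  (D ∉ 𝒞₁ → ∃ S₁ S₂ : Finset (Fin r.N), Disjoint S₁ S₂ ∧ S₁ ∪ S₂ = r.goodᶜ ∧
    (∀ i ∈ S₁, r.piece i ∈ 𝒞₁) ∧
    (∑ i ∈ S₁, perimeter (r.piece i) ≤ ENNReal.ofReal c₀ * perimeter D) ∧
    (∑ i ∈ S₂, perimeter (r.piece i) ≤ ENNReal.ofReal C₂ * perimeter D))

/-- Perimeter and closeness bounds for a replacement in the second phase; `ε` is the exponentially
small quantity `C₃ c₂^k`. -/
def SecondPhaseBounds {n : ℕ} {𝒞 : Set (Set (Vec n))} {V : Set (Mat n)} {v₁ C₃ : ℝ}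
    {M : Mat n} {D : Set (Vec n)} (r : Replacement 𝒞 V v₁ C₃ M D) (C₁ ε : ℝ) : Prop :=
  (∑ i, perimeter (r.piece i) ≤ ENNReal.ofReal C₁ * perimeter D) ∧
  ∃ S : Set (Vec n), MeasurableSet S ∧ S ⊆ (⋃ i ∈ r.good, r.piece i) ∧
    ENNReal.ofReal (1 - ε) * (∑ i ∈ r.good, volume (r.piece i)) ≤ volume S ∧
    ∀ i ∈ r.good, ∀ x ∈ S ∩ r.piece i, matNorm (r.grad i - M) ≤ ε

/-- Replacement constructions associated with two families `Vt`, `V` of sets of matrices, with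
perimeter and volume fraction bounds, exponential closeness and bounded gradients. The special
class `𝒞₁ k j M` may depend on the level and on the matrix that is replaced. -/
structure ReplacementSystem {n : ℕ} (m : ℕ) (𝒞 : Set (Set (Vec n)))
    (𝒞₁ : ℕ → ℕ → Mat n → Set (Set (Vec n))) (Vt V : ℕ → ℕ → Set (Mat n))
    (C₀ : ℕ → ℕ → ℝ) (C₁ C₂ C₃ v₁ c₂ : ℝ) : Prop where
  first : ∀ k j, j < m → ∀ M ∈ Vt k j, ∀ D ∈ 𝒞,
    ∃ r : Replacement 𝒞 (Vt k (j + 1)) v₁ C₃ M D,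
      FirstPhaseBounds r (𝒞₁ k j M) (C₀ j k) C₂
  second : ∀ k j, j < m → ∀ M ∈ V k j, ∀ D ∈ 𝒞,
    ∃ r : Replacement 𝒞 (V k (j + 1)) v₁ C₃ M D,
      SecondPhaseBounds r C₁ (C₃ * c₂ ^ k)

/-! ### The structural assumptions on `K` -/

/-- `K` is the union of the finitely many well-separated orbits `G M_1, …, G M_N` of a group `G`
acting on `K^{lc}`, and `K^{lc}` has nonempty interior relative to the ambient set `A`. -/
structure WellStructure {n : ℕ} (A K : Set (Mat n)) (G : Type*) [Group G]
    [MulAction G (lamHull K)] (N : ℕ) (well : Fin N → lamHull K) : Prop where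
  well_mem : ∀ l, (well l : Mat n) ∈ K
  eq_iUnion : K = ⋃ l, Subtype.val '' MulAction.orbit G (well l)
  disjoint : ∀ i j, i ≠ j → Disjoint (MulAction.orbit G (well i)) (MulAction.orbit G (well j))
  separated : ∃ c₁ : ℝ, 0 < c₁ ∧ ∀ i j, i ≠ j → ∀ P ∈ MulAction.orbit G (well i),
    ∀ Q ∈ MulAction.orbit G (well j), c₁ ≤ matNorm ((P : Mat n) - (Q : Mat n))
  subset_ambient : lamHull K ⊆ A
  nonempty : (relInt A (lamHull K)).Nonempty

/-- A subset of `K^{lc}` that is invariant under the action of `G`. -/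
def IsOrbitInvariant {n : ℕ} {K : Set (Mat n)} (G : Type*) [Group G] [MulAction G (lamHull K)]
    (S : Set (Mat n)) : Prop :=
  ∀ (g : G) (P : lamHull K), (P : Mat n) ∈ S → ((g • P : lamHull K) : Mat n) ∈ S

/-- The group-invariant in-approximation `Ũ_k^j`, `U_k^j`, `k ∈ ℕ`, `0 ≤ j ≤ m`. -/
structure InvariantInApproximation {n : ℕ} (m : ℕ) (A K : Set (Mat n)) (G : Type*) [Group G]
    [MulAction G (lamHull K)] (Ut U : ℕ → ℕ → Set (Mat n)) : Prop where
  subset_t : ∀ k j, j ≤ m → Ut k j ⊆ relInt A (lamHull K)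
  subset : ∀ k j, j ≤ m → U k j ⊆ relInt A (lamHull K)
  invariant_t : ∀ k j, j ≤ m → IsOrbitInvariant (K := K) G (Ut k j)
  invariant : ∀ k j, j ≤ m → IsOrbitInvariant (K := K) G (U k j)
  covers : relInt A (lamHull K) = ⋃ k, ⋃ j, ⋃ (_ : j ≤ m), Ut k j
  match_t : ∀ k, Ut k m = U k m
  match_succ : ∀ k, U k m = U (k + 1) 0
  inApprox : ∀ k, IsInApproximation A K (chain m Ut U k)
  dist_tendsto : ∀ j, j ≤ m → ∀ ε : ℝ, 0 < ε → ∃ k₁, ∀ k, k₁ ≤ k →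
    ∀ M ∈ U k j, ∃ Q ∈ K, matNorm (M - Q) < ε

/-- Replacement constructions for the in-approximation. For every initial matrix `M₀ ∈ Ũ_k^j` they
are available, with gradients bounded by `C₃ M₀`, on subfamilies `Vt ⊆ Ũ`, `V ⊆ U` with
`M₀ ∈ Vt_k^j` that are compatible with the constructions. If the constructions on all of `Ũ`, `U`
have bounded gradients, one takes `Vt = Ũ`, `V = U`; the subfamilies are needed because `Ũ`, `U`
are unbounded when the orbits of the group are. -/
def HasReplacements {n : ℕ} (m : ℕ) (𝒞 : Set (Set (Vec n)))
    (𝒞₁ : ℕ → ℕ → Mat n → Set (Set (Vec n))) (Ut U : ℕ → ℕ → Set (Mat n))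
    (C₀ : ℕ → ℕ → ℝ) (C₁ C₂ : ℝ) (C₃ : Mat n → ℝ) (v₁ c₂ : ℝ) : Prop :=
  ∀ k j, j ≤ m → ∀ M₀ ∈ Ut k j, ∃ Vt V : ℕ → ℕ → Set (Mat n),
    (∀ k' j', j' ≤ m → Vt k' j' ⊆ Ut k' j' ∧ V k' j' ⊆ U k' j') ∧
    (∀ k', Vt k' m = V k' m ∧ V k' m = V (k' + 1) 0) ∧
    M₀ ∈ Vt k j ∧
    ReplacementSystem m 𝒞 𝒞₁ Vt V C₀ C₁ C₂ (C₃ M₀) v₁ c₂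

/-! ### Sobolev spaces -/

/-- `F` is the weak gradient of `u : ℝⁿ → ℝⁿ`, `F i j = ∂_j u_i`. -/
structure HasWeakGradient {n : ℕ} (u : Vec n → Vec n) (F : Vec n → Mat n) : Prop where
  locInt : ∀ i, LocallyIntegrable (fun x => u x i) volume
  locInt_grad : ∀ i j, LocallyIntegrable (fun x => F x i j) volume
  integral_eq : ∀ φ : Vec n → ℝ, ContDiff ℝ ∞ φ → HasCompactSupport φ → ∀ i j,
    ∫ x, u x i * fderiv ℝ φ x (EuclideanSpace.single j 1) = - ∫ x, F x i j * φ x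

/-- `u ∈ W^{1,∞}_loc(ℝⁿ)` with weak gradient `F`. -/
def MemW1InftyLoc {n : ℕ} (u : Vec n → Vec n) (F : Vec n → Mat n) : Prop :=
  HasWeakGradient u F ∧
  ∀ R : ℝ, ∃ B : ℝ, ∀ᵐ x ∂(volume.restrict (Metric.ball 0 R)), ‖u x‖ ≤ B ∧ matNorm (F x) ≤ B

/-- The `W^{s,p}(D)` (Sobolev–Slobodeckij) norm
`(∫_D |F|^p + ∫_D ∫_D |F x - F y|^p / |x - y|^{n + s p})^{1/p}`. -/
def wspNorm {n : ℕ} (s p : ℝ) (D : Set (Vec n)) (F : Vec n → Mat n) : ℝ≥0∞ :=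
  ((∫⁻ x in D, ENNReal.ofReal (matNorm (F x) ^ p)) +
    ∫⁻ x in D, ∫⁻ y in D,
      ENNReal.ofReal (matNorm (F x - F y) ^ p / dist x y ^ ((n : ℝ) + s * p))) ^ (1 / p)

/-- `F ∈ W^{s,p}(D)`. -/
def MemWsp {n : ℕ} (s p : ℝ) (D : Set (Vec n)) (F : Vec n → Mat n) : Prop :=
  (∀ i j, AEMeasurable (fun x => F x i j) (volume.restrict D)) ∧ wspNorm s p D F < ⊤

end

/-! Start from the affine map on `Ω` and, at every step, replace it on every piece at once. Good
pieces move up one level in the in-approximation; bad pieces keep their gradient and level. Levels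
differ from piece to piece, so progress is measured by the mass `∑ μ^level |piece|` with `μ^m = c₂`.
A fraction at least `v₁` of each piece gains a factor `μ`, hence the mass contracts by `τ = 1 - (1 -
μ) v₁ < 1`. The gradient increment on a piece of level `l` costs at most `κ μ^l |piece|` in `L¹`: in
the second phase by exponential closeness, in the first because `μ^l` is bounded below there. So
increments decay like `τ^i` in `L¹` (`Stage.exists_refines`).

Translating the indicator of a piece by `h` costs at most `|h|` times its perimeter, so the
variation of the `i`-th gradient is controlled by the total perimeter. The nonuniform constant of
the first phase must not enter its growth rate. Perimeters are therefore weighted by powers of that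
constant whose exponent drops whenever the constant is paid (`phaseWeight`,
`Replacement.sum_phaseWeight_le`). The weighted perimeter grows at most by `Λ = C₁ + C₂ + 2` per
step, and the nonuniform constant survives only in the prefactor.

Interpolating between decay `τ^i` and growth `Λ^i |h|`, the series of increments satisfies an `L¹`
Nikolskii estimate of order `θ` as soon as `τ^(1-θ) Λ^θ < 1`
(`lintegral_translate_sub_le_of_tendsto`). With the uniform bound on the gradients this gives
`W^{s,p}` for `s p < θ` (`wspNorm_le`), and `θ` depends only on the admissible constants.

Summability of the masses forces the level at almost every point to infinity. Levels rise by at most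
one per step, so each late level is visited, and the limit condition of the in-approximation puts
the limit gradient in `K` (`exists_limit_of_hasSteps`). -/

noncomputable section

/-! ### Matrices as vectors and as linear maps -/

/-- The Euclidean space of matrix entries. -/
abbrev MatVec (n : ℕ) : Type := EuclideanSpace ℝ (Fin n × Fin n)

/-- A matrix as the vector of its entries. -/
def matVec {n : ℕ} (A : Mat n) : MatVec n := WithLp.toLp 2 fun p => A p.1 p.2

/-- The matrix with given vector of entries. -/
def vecMat {n : ℕ} (v : MatVec n) : Mat n := fun i j => v (i, j)

@[simp] lemma matVec_apply {n : ℕ} (A : Mat n) (p : Fin n × Fin n) : matVec A p = A p.1 p.2 := rfl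

@[simp] lemma vecMat_apply {n : ℕ} (v : MatVec n) (i j : Fin n) : vecMat v i j = v (i, j) := rfl

@[simp] lemma vecMat_matVec {n : ℕ} (A : Mat n) : vecMat (matVec A) = A := rfl

@[simp] lemma matVec_vecMat {n : ℕ} (v : MatVec n) : matVec (vecMat v) = v := by
  ext p; rfl

lemma matVec_sub {n : ℕ} (A B : Mat n) : matVec (A - B) = matVec A - matVec B := by
  ext p; simp

lemma vecMat_sub {n : ℕ} (v w : MatVec n) : vecMat (v - w) = vecMat v - vecMat w := rfl

lemma matNorm_eq {n : ℕ} (A : Mat n) : matNorm A = ‖matVec A‖ := by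
  rw [matNorm, EuclideanSpace.norm_eq, Fintype.sum_prod_type]
  simp

lemma continuous_vecMat {n : ℕ} : Continuous (vecMat : MatVec n → Mat n) := by
  refine continuous_pi fun i => continuous_pi fun j => ?_
  simp only [vecMat_apply]
  fun_prop

/-- The continuous linear map given by a matrix. -/
def matCLM {n : ℕ} (M : Mat n) : Vec n →L[ℝ] Vec n :=
  LinearMap.toContinuousLinearMap (Matrix.toEuclideanLin M)

lemma matCLM_apply {n : ℕ} (M : Mat n) (x : Vec n) : matCLM M x = matApply M x := rfl

lemma matApply_apply {n : ℕ} (M : Mat n) (x : Vec n) (i : Fin n) :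
    matApply M x i = ∑ j, M i j * x j := by
  simp [matApply, Matrix.toLpLin_apply, Matrix.mulVec, dotProduct]

lemma matApply_single {n : ℕ} (M : Mat n) (i j : Fin n) :
    matApply M (EuclideanSpace.single j 1) i = M i j := by
  simp [matApply_apply]

lemma norm_matApply_le {n : ℕ} (M : Mat n) (x : Vec n) :
    ‖matApply M x‖ ≤ matNorm M * ‖x‖ := by
  rw [EuclideanSpace.norm_eq, EuclideanSpace.norm_eq, matNorm, ← Real.sqrt_mul (by positivity)]
  apply Real.sqrt_le_sqrt
  rw [Finset.sum_mul]
  refine Finset.sum_le_sum fun i _ => ?_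
  rw [matApply_apply, Real.norm_eq_abs, sq_abs]
  simpa using Finset.sum_mul_sq_le_sq_mul_sq Finset.univ (fun j => M i j) (fun j => x j)

lemma matApply_sub {n : ℕ} (M : Mat n) (x y : Vec n) :
    matApply M (x - y) = matApply M x - matApply M y := map_sub (matCLM M) x y

lemma matApply_sub_left {n : ℕ} (M N : Mat n) (x : Vec n) :
    matApply (M - N) x = matApply M x - matApply N x := by
  ext i; simp [matApply_apply, sub_mul, Finset.sum_sub_distrib]

lemma matCLM_sub {n : ℕ} (M N : Mat n) : matCLM (M - N) = matCLM M - matCLM N := by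
  ext1 x; exact matApply_sub_left M N x

lemma continuous_matApply {n : ℕ} (M : Mat n) : Continuous (matApply M) := (matCLM M).continuous

lemma matNorm_nonneg {n : ℕ} (M : Mat n) : 0 ≤ matNorm M := Real.sqrt_nonneg _

/-! ### Piecewise affine maps -/

/-- A continuous selection of finitely many Lipschitz maps is Lipschitz. -/
lemma lipschitzWith_of_selection {E F ι : Type*} [NormedAddCommGroup E] [NormedSpace ℝ E]
    [NormedAddCommGroup F] [Finite ι] {C : NNReal} {f : ι → E → F}
    (hf : ∀ i, LipschitzWith C (f i)) {u : E → F} (hu : Continuous u)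
    (h : ∀ x, ∃ i, u x = f i x) : LipschitzWith C u := by
  refine LipschitzWith.of_dist_le_mul fun x y => ?_
  rw [dist_comm (u x), dist_comm x, dist_eq_norm, dist_eq_norm]
  set γ : ℝ → E := fun t => x + t • (y - x) with hγ
  have hγc : Continuous γ := by fun_prop
  have key : ∀ t₀ : ℝ, ∀ᶠ t in 𝓝 t₀, ‖u (γ t) - u (γ t₀)‖ ≤ C * ‖y - x‖ * |t - t₀| := by
    intro t₀
    -- By continuity, an index that is not active at `t₀` stays inactive nearby. So whichever of the
    -- finitely many indices is active at a nearby `t` is active at `t₀` too.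
    have h1 : ∀ i, ∀ᶠ t in 𝓝 t₀, u (γ t) = f i (γ t) → u (γ t₀) = f i (γ t₀) := by
      intro i
      by_cases hi : u (γ t₀) = f i (γ t₀)
      · exact Eventually.of_forall fun _ _ => hi
      · filter_upwards [(((hu.comp hγc).tendsto t₀).sub
          (((hf i).continuous.comp hγc).tendsto t₀)).eventually_ne (sub_ne_zero.2 hi)] with t ht h'
        exact absurd h' (sub_ne_zero.1 ht)
    filter_upwards [eventually_all.2 h1] with t ht
    obtain ⟨i, hi⟩ := h (γ t)
    rw [hi, ht i hi, ← dist_eq_norm]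
    refine ((hf i).dist_le_mul _ _).trans (le_of_eq ?_)
    rw [dist_eq_norm, hγ]
    simp only [add_sub_add_left_eq_sub, ← sub_smul, norm_smul, Real.norm_eq_abs]
    ring
  have := image_le_of_liminf_slope_right_le_deriv_boundary
    (f := fun t => ‖u (γ t) - u x‖) (a := 0) (b := 1) (B := fun t => C * ‖y - x‖ * t)
    (B' := fun _ => C * ‖y - x‖) (by fun_prop) (by simp [hγ]) (by fun_prop)
    (fun t _ => by simpa using ((hasDerivAt_id t).const_mul (C * ‖y - x‖)).hasDerivWithinAt) ?_
    (right_mem_Icc.2 zero_le_one)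
  · simpa [hγ] using this
  · intro t _ r hr
    refine Eventually.frequently ?_
    filter_upwards [(key t).filter_mono nhdsWithin_le_nhds, self_mem_nhdsWithin] with z hz hz'
    have hz' : 0 < z - t := sub_pos.2 hz'
    refine lt_of_le_of_lt ?_ hr
    rw [slope_def_field, div_le_iff₀ hz']
    rw [abs_of_pos hz'] at hz
    refine le_trans ?_ hz
    refine (le_abs_self _).trans ((abs_norm_sub_norm_le _ _).trans (le_of_eq ?_))
    congr 1; abel

lemma lipschitzWith_matApply_add {n : ℕ} (M : Mat n) (b : Vec n) {L : ℝ} (h : matNorm M ≤ L) :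
    LipschitzWith L.toNNReal fun x => matApply M x + b := by
  refine LipschitzWith.of_dist_le_mul fun x y => ?_
  rw [dist_add_right, dist_eq_norm, dist_eq_norm, ← matApply_sub,
    Real.coe_toNNReal _ ((matNorm_nonneg M).trans h)]
  exact (norm_matApply_le _ _).trans (by gcongr)

/-- A continuous map that is affine on each of finitely many sets that cover almost everything is
Lipschitz. -/
lemma lipschitzWith_of_piecewise_affine {n : ℕ} {ι : Type*} [Finite ι] {S : ι → Set (Vec n)}
    {M : ι → Mat n} {b : ι → Vec n} {u : Vec n → Vec n} {L : ℝ} (hM : ∀ i, matNorm (M i) ≤ L)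
    (hu : Continuous u) (hS : ∀ᵐ x, ∃ i, x ∈ S i)
    (h : ∀ i, ∀ x ∈ S i, u x = matApply (M i) x + b i) : LipschitzWith L.toNNReal u := by
  refine lipschitzWith_of_selection (fun i => lipschitzWith_matApply_add (M i) (b i) (hM i)) hu ?_
  -- The set where `u` agrees with one of the affine maps is closed, and it is dense because it has
  -- full measure; hence it is everything.
  have hcl : IsClosed (⋃ i, {x | u x = matApply (M i) x + b i}) :=
    isClosed_iUnion_of_finite fun i =>
      isClosed_eq hu ((continuous_matApply _).add continuous_const)
  have hd : Dense (⋃ i, {x | u x = matApply (M i) x + b i}) := by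
    refine (Measure.dense_of_ae hS).mono ?_
    rintro x ⟨i, hi⟩
    exact mem_iUnion.2 ⟨i, h i x hi⟩
  intro x
  have : x ∈ ⋃ i, {x | u x = matApply (M i) x + b i} := by
    rw [← hcl.closure_eq]; exact hd x
  simpa using this

/-- `u` is differentiable a.e. by Rademacher, and at almost every point of a measurable set the
derivative is determined by the values on that set. No openness is needed, so one of the sets may be
the complement of `Ω`. -/
lemma ae_hasFDerivAt_of_piecewise_affine {n : ℕ} {ι : Type*} [Finite ι] {S : ι → Set (Vec n)}
    {M : ι → Mat n} {b : ι → Vec n} {u : Vec n → Vec n} {F : Vec n → Mat n} {C : NNReal}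
    (hmeas : ∀ i, MeasurableSet (S i)) (hu : LipschitzWith C u) (hS : ∀ᵐ x, ∃ i, x ∈ S i)
    (h : ∀ i, ∀ x ∈ S i, u x = matApply (M i) x + b i) (hF : ∀ i, ∀ x ∈ S i, F x = M i) :
    ∀ᵐ x, HasFDerivAt u (matCLM (F x)) x := by
  have h1 : ∀ i, ∀ᵐ x, x ∈ S i → DifferentiableAt ℝ u x → fderiv ℝ u x = matCLM (M i) := by
    intro i
    set s := S i ∩ {x | DifferentiableAt ℝ u x}
    have hs : MeasurableSet s := (hmeas i).inter (measurableSet_of_differentiableAt ℝ u)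
    have ha : ApproximatesLinearOn u (matCLM (M i)) s 0 := by
      intro x hx y hy
      rw [h i x hx.1, h i y hy.1, matCLM_apply, matApply_sub]
      simp
    have := ha.norm_fderiv_sub_le volume hs (fderiv ℝ u)
      fun x hx => (DifferentiableAt.hasFDerivAt hx.2).hasFDerivWithinAt
    rw [ae_restrict_iff' hs] at this
    filter_upwards [this] with x hx h2 h3
    have := hx ⟨h2, h3⟩
    simpa [sub_eq_zero] using this
  filter_upwards [hS, eventually_countable_forall.2 h1, hu.ae_differentiableAt] with x ⟨i, hi⟩ h2 h3
  rw [hF i x hi, ← h2 i hi h3]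
  exact h3.hasFDerivAt

/-- Rademacher: the weak gradient of a Lipschitz map is its pointwise gradient. -/
lemma hasWeakGradient_of_lipschitz {n : ℕ} {u : Vec n → Vec n} {F : Vec n → Mat n} {C : NNReal}
    (hu : LipschitzWith C u) (hF : ∀ᵐ x, HasFDerivAt u (matCLM (F x)) x)
    (hloc : ∀ i j, LocallyIntegrable (fun x => F x i j) volume) : HasWeakGradient u F where
  locInt i := Continuous.locallyIntegrable (by
    have := hu.continuous
    fun_prop)
  locInt_grad := hloc
  integral_eq φ hφ hφc i j := by
    obtain ⟨D, hD⟩ := (hφ.of_le (m := 1) (by exact_mod_cast le_top)).lipschitzWith_of_hasCompactSupport hφc one_ne_zero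
    have hui : LipschitzWith C fun x => u x i := by
      refine LipschitzWith.of_dist_le_mul fun x y => ?_
      refine le_trans ?_ (hu.dist_le_mul x y)
      rw [dist_eq_norm, dist_eq_norm, ← PiLp.sub_apply]
      exact PiLp.norm_apply_le _ _
    have := hui.integral_lineDeriv_mul_eq (μ := volume) hD hφc (EuclideanSpace.single j 1)
    rw [integral_congr_ae (g := fun x => F x i j * φ x)] at this
    · rw [this, ← integral_neg]
      refine integral_congr_ae (Eventually.of_forall fun x => ?_)
      have hd : DifferentiableAt ℝ φ x := (hφ.differentiable (by simp)) x
      simp only [hd.lineDeriv_eq_fderiv, map_neg]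
      ring
    · filter_upwards [hF] with x hx
      have h1 : HasFDerivAt (fun x => u x i) ((EuclideanSpace.proj i).comp (matCLM (F x))) x :=
        (EuclideanSpace.proj (𝕜 := ℝ) i).hasFDerivAt.comp x hx
      rw [h1.differentiableAt.lineDeriv_eq_fderiv, h1.fderiv]
      simp [matCLM_apply, matApply_single]

/-- Poincaré inequality for Lipschitz maps that vanish off a ball. -/
lemma lintegral_enorm_le_of_lipschitz {n : ℕ} (hn : 1 ≤ n) {w : Vec n → Vec n} {G : Vec n → Mat n}
    {C : NNReal} {R : ℝ} (hw : LipschitzWith C w) (hG : ∀ᵐ x, HasFDerivAt w (matCLM (G x)) x)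
    (h0 : ∀ x, R < ‖x‖ → w x = 0) :
    ∫⁻ x, ‖w x‖ₑ ≤ ENNReal.ofReal R * ∫⁻ x, ‖matVec (G x)‖ₑ := by
  rcases lt_or_ge R 0 with hR | hR
  · have : ∀ x, w x = 0 := fun x => h0 x (hR.trans_le (norm_nonneg x))
    simp [this]
  set i₀ : Fin n := ⟨0, hn⟩
  set e : Vec n := EuclideanSpace.single i₀ 1 with he
  -- Since `∂x_{i₀}/∂x_{i₀} = 1`, integration by parts moves a derivative onto `|w|` and leaves the
  -- factor `x_{i₀}`, bounded by `R` where `w` lives.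
  have hf : LipschitzWith 1 fun x : Vec n => x i₀ := by
    refine LipschitzWith.of_dist_le_mul fun x y => ?_
    rw [dist_eq_norm, dist_eq_norm, ← PiLp.sub_apply, NNReal.coe_one, one_mul]
    exact PiLp.norm_apply_le _ _
  have hg : LipschitzWith C fun x => ‖w x‖ := by
    simpa [Function.comp_def] using lipschitzWith_one_norm.comp hw
  have hwc : HasCompactSupport w :=
    HasCompactSupport.of_support_subset_isCompact (isCompact_closedBall (0 : Vec n) R) fun x hx => by
      by_contra h
      exact hx (h0 x (by simpa using h))
  have hmain := hf.integral_lineDeriv_mul_eq (μ := volume) hg hwc.norm e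
  have hld : ∀ x : Vec n, lineDeriv ℝ (fun x : Vec n => x i₀) x e = 1 := fun x => by
    have h1 : HasFDerivAt (fun x : Vec n => x i₀) (EuclideanSpace.proj i₀ : Vec n →L[ℝ] ℝ) x :=
      (EuclideanSpace.proj (𝕜 := ℝ) i₀).hasFDerivAt
    rw [h1.differentiableAt.lineDeriv_eq_fderiv, h1.fderiv]
    simp [he]
  simp only [hld, one_mul] at hmain
  have hint : Integrable w := hw.continuous.integrable_of_hasCompactSupport hwc
  rw [← ofReal_integral_norm_eq_lintegral_enorm hint, hmain]
  have hle : ∀ᵐ x, ‖lineDeriv ℝ (fun x => ‖w x‖) x (-e) * x i₀‖ₑ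
      ≤ ENNReal.ofReal R * ‖matVec (G x)‖ₑ := by
    filter_upwards [hG, hg.ae_lineDifferentiableAt (μ := volume) (-e)] with x hx hx'
    rw [enorm_mul, mul_comm]
    rcases le_or_gt ‖x‖ R with hxR | hxR
    · gcongr
      · rw [← ofReal_norm]
        exact ENNReal.ofReal_le_ofReal ((PiLp.norm_apply_le _ _).trans hxR)
      · rw [← ofReal_norm, ← ofReal_norm]
        refine ENNReal.ofReal_le_ofReal ?_
        -- Difference quotients of `|w|` are dominated by those of `w`, and so is the derivative in
        -- the limit.
        have h1 := (hx'.hasLineDerivAt.tendsto_slope_zero_right).norm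
        have h2 := ((hx.hasLineDerivAt (-e)).tendsto_slope_zero_right).norm
        refine (le_of_tendsto_of_tendsto' h1 h2 fun t => ?_).trans ?_
        · rw [norm_smul, norm_smul]
          gcongr
          exact abs_norm_sub_norm_le _ _
        · rw [matCLM_apply, ← matNorm_eq]
          refine (norm_matApply_le _ _).trans ?_
          simp [he]
    · have : lineDeriv ℝ (fun x => ‖w x‖) x (-e) = 0 := by
        have h1 : (fun x => ‖w x‖) =ᶠ[𝓝 x] fun _ => 0 := by
          filter_upwards [continuous_norm.continuousAt.eventually (lt_mem_nhds hxR)] with y hy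
          simp [h0 y hy]
        rw [h1.lineDeriv_eq]
        simp [lineDeriv]
      simp [this]
  calc ENNReal.ofReal (∫ x, lineDeriv ℝ (fun x => ‖w x‖) x (-e) * x i₀)
      ≤ ‖∫ x, lineDeriv ℝ (fun x => ‖w x‖) x (-e) * x i₀‖ₑ := by
        rw [← ofReal_norm]
        exact ENNReal.ofReal_le_ofReal (le_abs_self _)
    _ ≤ ∫⁻ x, ‖lineDeriv ℝ (fun x => ‖w x‖) x (-e) * x i₀‖ₑ := enorm_integral_le_lintegral_enorm _
    _ ≤ ∫⁻ x, ENNReal.ofReal R * ‖matVec (G x)‖ₑ := lintegral_mono_ae hle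
    _ = _ := lintegral_const_mul' _ _ ENNReal.ofReal_ne_top

/-- The gradient of a Lipschitz map of compact support has mean zero. -/
lemma integral_grad_eq_zero_of_lipschitz {n : ℕ} {w : Vec n → Vec n} {G : Vec n → Mat n}
    {C : NNReal} (hw : LipschitzWith C w) (hG : ∀ᵐ x, HasFDerivAt w (matCLM (G x)) x)
    (hc : HasCompactSupport w) (i j : Fin n) : ∫ x, G x i j = 0 := by
  have hwi : LipschitzWith C fun x => w x i := by
    refine LipschitzWith.of_dist_le_mul fun x y => ?_
    refine le_trans ?_ (hw.dist_le_mul x y)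
    rw [dist_eq_norm, dist_eq_norm, ← PiLp.sub_apply]
    exact PiLp.norm_apply_le _ _
  have hci : HasCompactSupport fun x => w x i := hc.comp_left (g := fun v : Vec n => v i) rfl
  -- Integration by parts against the constant `1`.
  have := (LipschitzWith.const (1 : ℝ)).integral_lineDeriv_mul_eq (μ := volume) hwi hci
    (-EuclideanSpace.single j (1 : ℝ))
  simp only [lineDeriv, deriv_const, zero_mul, integral_zero, neg_neg, mul_one] at this
  refine Eq.trans ?_ this.symm
  refine integral_congr_ae ?_
  filter_upwards [hG] with x hx
  change _ = lineDeriv ℝ (fun x => w x i) x (EuclideanSpace.single j 1)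
  have h1 : HasFDerivAt (fun x => w x i) ((EuclideanSpace.proj i).comp (matCLM (G x))) x :=
    (EuclideanSpace.proj (𝕜 := ℝ) i).hasFDerivAt.comp x hx
  rw [h1.differentiableAt.lineDeriv_eq_fderiv, h1.fderiv]
  simp [matCLM_apply, matApply_single]

/-! ### Translations and the perimeter -/

lemma divergence_smul_const {n : ℕ} {f : Vec n → ℝ} {x : Vec n} (hf : DifferentiableAt ℝ f x)
    (v : Vec n) : divergence (fun y => f y • v) x = fderiv ℝ f x v := by
  have h1 : fderiv ℝ (fun y => f y • v) x = (fderiv ℝ f x).smulRight v :=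
    (hf.hasFDerivAt.smul_const v).fderiv
  rw [divergence, h1]
  conv_rhs => rw [← (EuclideanSpace.basisFun (Fin n) ℝ).sum_repr v]
  simp [mul_comm]

lemma abs_integral_divergence_le {n : ℕ} {D : Set (Vec n)} (hD : perimeter D ≠ ⊤)
    {φ : Vec n → Vec n} (hφ : ContDiff ℝ 1 φ) (hc : HasCompactSupport φ) (h1 : ∀ x, ‖φ x‖ ≤ 1) :
    |∫ x in D, divergence φ x| ≤ (perimeter D).toReal := by
  have key : ∀ ψ : Vec n → Vec n, ContDiff ℝ 1 ψ → HasCompactSupport ψ → (∀ x, ‖ψ x‖ ≤ 1) →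
      ∫ x in D, divergence ψ x ≤ (perimeter D).toReal := by
    intro ψ h1 h2 h3
    rw [← ENNReal.ofReal_le_iff_le_toReal hD]
    exact le_iSup₂ (f := fun (φ : Vec n → Vec n)
      (_ : ContDiff ℝ 1 φ ∧ HasCompactSupport φ ∧ ∀ x, ‖φ x‖ ≤ 1) =>
      ENNReal.ofReal (∫ x in D, divergence φ x)) ψ ⟨h1, h2, h3⟩
  rw [abs_le]
  refine ⟨?_, key φ hφ hc h1⟩
  have := key (fun x => -φ x) hφ.neg hc.neg (by simpa using h1)
  have h2 : ∀ x, divergence (fun x => -φ x) x = -divergence φ x := fun x => by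
    simp [divergence, fderiv_fun_neg]
  simp only [h2, integral_neg] at this
  linarith

/-- Move the test function along the segment from `0` to `h`. The derivative in `t` is `‖h‖` times
the integral over `D` of the divergence of a translate of `φ` times the unit vector `-h/‖h‖`, an
admissible field in the definition of perimeter. -/
lemma abs_integral_translate_sub_le {n : ℕ} {D : Set (Vec n)}
    (hb : volume D ≠ ⊤) (hD : perimeter D ≠ ⊤) {φ : Vec n → ℝ} (hφ : ContDiff ℝ 1 φ)
    (hc : HasCompactSupport φ) (h1 : ∀ x, ‖φ x‖ ≤ 1) (h : Vec n) :
    |(∫ x in D, φ (x - h)) - ∫ x in D, φ x| ≤ ‖h‖ * (perimeter D).toReal := by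
  obtain ⟨B, hB⟩ := (hφ.continuous_fderiv one_ne_zero).bounded_above_of_compact_support
    (hc.fderiv (𝕜 := ℝ))
  have : IsFiniteMeasure (volume.restrict D) := ⟨by simpa using hb.lt_top⟩
  have hdiff : ∀ x, HasFDerivAt φ (fderiv ℝ φ x) x := fun x =>
    (hφ.differentiable one_ne_zero x).hasFDerivAt
  have hderiv : ∀ t : ℝ, HasDerivAt (fun t : ℝ => ∫ x in D, φ (x - t • h))
      (∫ x in D, -fderiv ℝ φ (x - t • h) h) t := by
    intro t
    refine (hasDerivAt_integral_of_dominated_loc_of_deriv_le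
      (F := fun (t : ℝ) (x : Vec n) => φ (x - t • h))
      (F' := fun (t : ℝ) (x : Vec n) => -fderiv ℝ φ (x - t • h) h)
      (bound := fun _ => B * ‖h‖) univ_mem (Eventually.of_forall fun s => ?_) ?_ ?_ ?_
      (integrable_const _) ?_).2
    · exact (hφ.continuous.comp (by fun_prop)).aestronglyMeasurable
    · exact Integrable.of_bound (hφ.continuous.comp (by fun_prop)).aestronglyMeasurable 1
        (Eventually.of_forall fun x => h1 _)
    · exact (((hφ.continuous_fderiv one_ne_zero).comp (f := fun x => x - t • h)
        (by fun_prop)).clm_apply continuous_const).neg.aestronglyMeasurable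
    · refine Eventually.of_forall fun x s _ => ?_
      rw [norm_neg]
      exact ContinuousLinearMap.le_of_opNorm_le _ (hB _) _
    · refine Eventually.of_forall fun x s _ => ?_
      have h2 : HasDerivAt (fun s : ℝ => x - s • h) (-h) s := by
        simpa using ((hasDerivAt_id s).smul_const h).const_sub x
      simpa [Function.comp_def] using (hdiff (x - s • h)).comp_hasDerivAt s h2
  have hbound : ∀ t : ℝ, ‖∫ x in D, -fderiv ℝ φ (x - t • h) h‖ ≤ ‖h‖ * (perimeter D).toReal := by
    intro t
    rcases eq_or_ne h 0 with rfl | hh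
    · simp
    have hh' : ‖h‖ ≠ 0 := norm_ne_zero_iff.2 hh
    have hsm : ContDiff ℝ 1 fun x => φ (x - t • h) := hφ.comp (by fun_prop)
    have hdiv : ∀ x, -fderiv ℝ φ (x - t • h) h
        = ‖h‖ * divergence (fun y => φ (y - t • h) • (-(‖h‖⁻¹ • h))) x := by
      intro x
      rw [divergence_smul_const (hsm.differentiable one_ne_zero x), map_neg, map_smul,
        fderiv_comp_sub (f := φ), smul_eq_mul]
      field_simp
    simp only [hdiv, integral_const_mul, norm_mul, norm_norm]
    gcongr
    refine abs_integral_divergence_le hD (hsm.smul contDiff_const) ?_ fun x => ?_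
    · exact (hc.comp_homeomorph (Homeomorph.subRight (t • h))).smul_right
    · rw [norm_smul, norm_neg, norm_smul, norm_inv, norm_norm, inv_mul_cancel₀ hh', mul_one]
      exact h1 _
  have := norm_image_sub_le_of_norm_deriv_le_segment_01'
    (fun t _ => (hderiv t).hasDerivWithinAt) fun t _ => hbound t
  simpa using this

/-- The difference `f` takes values in `{-1, 0, 1}`, so `|f| = f · f`. Mollifications of `f` are
admissible test functions, to which the previous bound applies, and they converge to `f` a.e. -/
lemma lintegral_indicator_translate_sub_le {n : ℕ} {D : Set (Vec n)} (ho : IsOpen D)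
    (hb : Bornology.IsBounded D) (hD : perimeter D ≠ ⊤) (h : Vec n) :
    ∫⁻ x, ‖D.indicator (fun _ => (1 : ℝ)) (x + h) - D.indicator (fun _ => (1 : ℝ)) x‖ₑ
      ≤ ‖h‖ₑ * perimeter D := by
  set χ : Vec n → ℝ := D.indicator fun _ => (1 : ℝ) with hχ
  have hvol : volume D ≠ ⊤ := hb.measure_lt_top.ne
  have hχi : Integrable χ := (integrable_indicator_iff ho.measurableSet).2
    (integrableOn_const hvol)
  have hχc : HasCompactSupport χ := HasCompactSupport.of_support_subset_isCompact
    (hb.isCompact_closure) (support_indicator_subset.trans subset_closure)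
  set f : Vec n → ℝ := fun x => χ (x + h) - χ x with hf
  have hfi : Integrable f := (hχi.comp_add_right h).sub hχi
  have hfc : HasCompactSupport f :=
    (hχc.comp_homeomorph (Homeomorph.addRight h)).sub hχc
  have hf1 : ∀ x, |f x| ≤ 1 ∧ f x * f x = |f x| := by
    intro x
    by_cases h1 : x + h ∈ D <;> by_cases h2 : x ∈ D <;> simp [f, χ, h1, h2]
  have htest : ∀ φ : Vec n → ℝ, ContDiff ℝ 1 φ → HasCompactSupport φ → (∀ x, ‖φ x‖ ≤ 1) →
      ∫ x, φ x * f x ≤ ‖h‖ * (perimeter D).toReal := by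
    intro φ hφ hc h1
    refine le_trans (le_of_eq ?_) ((le_abs_self _).trans
      (abs_integral_translate_sub_le hvol hD hφ hc h1 h))
    have hφm : AEStronglyMeasurable φ := hφ.continuous.aestronglyMeasurable
    have e1 : ∫ x, φ x * χ (x + h) = ∫ x in D, φ (x - h) := by
      rw [← integral_indicator ho.measurableSet,
        ← integral_add_right_eq_self (D.indicator fun x => φ (x - h)) h]
      refine integral_congr_ae (Eventually.of_forall fun x => ?_)
      by_cases h2 : x + h ∈ D <;> simp [χ, h2]
    have e2 : ∫ x, φ x * χ x = ∫ x in D, φ x := by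
      rw [← integral_indicator ho.measurableSet]
      refine integral_congr_ae (Eventually.of_forall fun x => ?_)
      by_cases h2 : x ∈ D <;> simp [χ, h2]
    rw [← e1, ← e2, ← integral_sub]
    · simp only [f, mul_sub]
    · exact (hχi.comp_add_right h).bdd_mul hφm (Eventually.of_forall h1)
    · exact hχi.bdd_mul hφm (Eventually.of_forall h1)
  -- The ratio of the two radii is constantly `2`; a bounded ratio is what a.e. convergence at
  -- Lebesgue points needs.
  let b : ℕ → ContDiffBump (0 : Vec n) := fun k =>
    ⟨1 / (k + 1), 2 / (k + 1), by positivity, by gcongr; norm_num⟩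
  set φ : ℕ → Vec n → ℝ := fun k =>
    convolution ((b k).normed volume) f (ContinuousLinearMap.lsmul ℝ ℝ) volume with hφ
  have hconv : ∀ᵐ x, Tendsto (fun k => φ k x) atTop (𝓝 (f x)) := by
    refine ContDiffBump.ae_convolution_tendsto_right_of_locallyIntegrable (K := 2) ?_ ?_
      hfi.locallyIntegrable
    · exact tendsto_const_div_atTop_nhds_zero_nat (2 : ℝ) |>.comp (tendsto_add_atTop_nat 1) |>.congr
        fun k => by simp [b]
    · refine Eventually.of_forall fun k => le_of_eq ?_
      simp only [b]; ring
  have hφ1 : ∀ k x, ‖φ k x‖ ≤ 1 := by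
    intro k x
    simp only [hφ, convolution_def]
    refine (norm_integral_le_of_norm_le ((b k).integrable_normed (μ := volume))
      (Eventually.of_forall fun t => ?_)).trans (b k).integral_normed.le
    rw [ContinuousLinearMap.lsmul_apply, norm_smul, Real.norm_of_nonneg ((b k).nonneg_normed t)]
    exact mul_le_of_le_one_right ((b k).nonneg_normed t) (hf1 _).1
  have hlim : Tendsto (fun k => ∫ x, φ k x * f x) atTop (𝓝 (∫ x, f x * f x)) := by
    have hφc : ∀ k, Continuous (φ k) := fun k =>
      ((b k).hasCompactSupport_normed.contDiff_convolution_left (n := 1) _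
        (b k).contDiff_normed hfi.locallyIntegrable).continuous
    refine tendsto_integral_of_dominated_convergence (fun x => ‖f x‖) (fun k =>
      ((hφc k).aestronglyMeasurable.mul hfi.1)) hfi.norm (fun k => Eventually.of_forall fun x => ?_) ?_
    · rw [norm_mul]
      exact mul_le_of_le_one_left (norm_nonneg _) (hφ1 k x)
    · filter_upwards [hconv] with x hx
      exact hx.mul_const _
  have hle : ∫ x, f x * f x ≤ ‖h‖ * (perimeter D).toReal :=
    le_of_tendsto' hlim fun k => htest (φ k)
      ((b k).hasCompactSupport_normed.contDiff_convolution_left (n := 1) _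
        (b k).contDiff_normed hfi.locallyIntegrable)
      ((b k).hasCompactSupport_normed.convolution _ hfc) (hφ1 k)
  rw [← ofReal_integral_norm_eq_lintegral_enorm hfi]
  simp only [(hf1 _).2] at hle
  refine (ENNReal.ofReal_le_ofReal hle).trans (le_of_eq ?_)
  rw [ENNReal.ofReal_mul (norm_nonneg _), ENNReal.ofReal_toReal hD, ofReal_norm]

/-! ### Nikolskii estimates and fractional Sobolev norms -/

/-- The integral of `|h|^(δ - n)` over a ball. -/
def rieszIntegral (n : ℕ) (δ R : ℝ) : ℝ≥0∞ :=
  ∫⁻ h in Metric.ball (0 : Vec n) R, ENNReal.ofReal (‖h‖ ^ (δ - n))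

lemma rieszIntegral_lt_top {n : ℕ} (hn : 1 ≤ n) {δ : ℝ} (hδ : 0 < δ) (R : ℝ) :
    rieszIntegral n δ R < ⊤ := by
  have : Nonempty (Fin n) := ⟨⟨0, hn⟩⟩
  have h1 : IntegrableOn (fun h : Vec n => ‖h‖ ^ (δ - n)) (Metric.ball (0 : Vec n) R) volume := by
    rw [integrableOn_fun_norm_addHaar (μ := volume) (f := fun y : ℝ => y ^ (δ - n))]
    have h2 : IntegrableOn (fun y : ℝ => y ^ (δ - 1)) (Ioo 0 R) := by
      rcases le_or_gt R 0 with hR | hR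
      · simp [Ioo_eq_empty_of_le hR]
      · exact (intervalIntegral.intervalIntegrable_rpow' (a := 0) (b := R) (by linarith)).1.mono_set
          Ioo_subset_Ioc_self
    refine h2.congr_fun (fun y hy => ?_) measurableSet_Ioo
    simp only [finrank_euclideanSpace, Fintype.card_fin, smul_eq_mul]
    rw [← Real.rpow_natCast, ← Real.rpow_add hy.1, Nat.cast_sub hn]
    congr 1; push_cast; ring
  have := h1.lintegral_lt_top
  exact this

/-- Of the `p` powers of `|F x - F y|`, all but one are absorbed by `2L`. With `y = x + h`, the
Nikolskii bound then leaves the kernel `|h|^(θ - sp - n)`, which is integrable near `0` when `sp <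
θ`. -/
lemma wspNorm_le {n : ℕ} {s p θ R L : ℝ} (hs : 0 < s) (hp : 1 < p) (hθ : s * p < θ)
    {D : Set (Vec n)} (hD : MeasurableSet D) (hDR : D ⊆ Metric.ball 0 R) {F : Vec n → MatVec n}
    (hF : Measurable F) (hFL : ∀ᵐ x, ‖F x‖ ≤ L) {B : ℝ≥0∞}
    (hB : ∀ h, ∫⁻ x, ‖F (x + h) - F x‖ₑ ≤ B * ‖h‖ₑ ^ θ) :
    wspNorm s p D (fun x => vecMat (F x)) ≤
      (ENNReal.ofReal (L ^ p) * volume D +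
        ENNReal.ofReal ((2 * L) ^ (p - 1)) * (B * rieszIntegral n (θ - s * p) (2 * R))) ^ (1 / p) := by
  have hL : 0 ≤ L := by
    obtain ⟨x, hx⟩ := hFL.exists
    exact (norm_nonneg _).trans hx
  have hsp : 0 < s * p := by positivity
  have hθ0 : 0 < θ := hsp.trans hθ
  -- Differences of points of `D` have norm below `2R`, so the kernel may be cut off there.
  set K : Vec n → ℝ≥0∞ := (Metric.ball (0 : Vec n) (2 * R)).indicator
    fun h => ENNReal.ofReal (‖h‖ ^ (-((n : ℝ) + s * p))) with hK
  have hKm : Measurable K := by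
    refine Measurable.indicator ?_ measurableSet_ball
    fun_prop
  have hpt : ∀ x ∈ D, ∀ y ∈ D, ‖F x‖ ≤ L → ‖F y‖ ≤ L →
      ENNReal.ofReal (matNorm (vecMat (F x) - vecMat (F y)) ^ p / dist x y ^ ((n : ℝ) + s * p))
      ≤ ENNReal.ofReal ((2 * L) ^ (p - 1)) * (‖F y - F x‖ₑ * K (y - x)) := by
    intro x hx y hy hxL hyL
    have hball : y - x ∈ Metric.ball (0 : Vec n) (2 * R) := by
      have h1 := hDR hx
      have h2 := hDR hy
      rw [mem_ball_zero_iff] at *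
      exact (norm_sub_le _ _).trans_lt (by linarith)
    rw [hK, indicator_of_mem hball, ← vecMat_sub, matNorm_eq, matVec_vecMat, dist_eq_norm,
      norm_sub_rev, norm_sub_rev x y, ← ofReal_norm, ← ENNReal.ofReal_mul (norm_nonneg _),
      ← ENNReal.ofReal_mul (by positivity)]
    refine ENNReal.ofReal_le_ofReal ?_
    rw [Real.rpow_neg (norm_nonneg _), div_eq_mul_inv, ← mul_assoc]
    gcongr
    have h3 : ‖F y - F x‖ ^ p = ‖F y - F x‖ ^ (p - 1) * ‖F y - F x‖ := by
      conv_lhs => rw [show p = (p - 1) + 1 by ring]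
      rw [Real.rpow_add_one' (norm_nonneg _) (by linarith)]
    rw [h3]
    gcongr
    exact (norm_sub_le _ _).trans (by linarith)
  have hA : ∫⁻ x in D, ENNReal.ofReal (matNorm (vecMat (F x)) ^ p)
      ≤ ENNReal.ofReal (L ^ p) * volume D := by
    rw [← setLIntegral_const]
    refine lintegral_mono_ae (ae_restrict_of_ae ?_)
    filter_upwards [hFL] with x hx
    rw [matNorm_eq, matVec_vecMat]
    gcongr
  have hC : ∫⁻ x in D, ∫⁻ y in D, ENNReal.ofReal
      (matNorm (vecMat (F x) - vecMat (F y)) ^ p / dist x y ^ ((n : ℝ) + s * p))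
      ≤ ENNReal.ofReal ((2 * L) ^ (p - 1)) * (B * rieszIntegral n (θ - s * p) (2 * R)) := by
    calc _ ≤ ∫⁻ x in D, ∫⁻ y in D,
            ENNReal.ofReal ((2 * L) ^ (p - 1)) * (‖F y - F x‖ₑ * K (y - x)) := by
          refine lintegral_mono_ae ?_
          filter_upwards [ae_restrict_of_ae hFL, ae_restrict_mem hD] with x hxL hx
          refine lintegral_mono_ae ?_
          filter_upwards [ae_restrict_of_ae hFL, ae_restrict_mem hD] with y hyL hy
          exact hpt x hx y hy hxL hyL
      _ ≤ ∫⁻ x, ∫⁻ y, ENNReal.ofReal ((2 * L) ^ (p - 1)) * (‖F y - F x‖ₑ * K (y - x)) :=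
          (lintegral_mono fun x => setLIntegral_le_lintegral _ _).trans
            (setLIntegral_le_lintegral _ _)
      _ = ENNReal.ofReal ((2 * L) ^ (p - 1)) * ∫⁻ x, ∫⁻ y, (‖F y - F x‖ₑ * K (y - x)) := by
          simp only [lintegral_const_mul' _ _ ENNReal.ofReal_ne_top]
      _ = ENNReal.ofReal ((2 * L) ^ (p - 1)) * ∫⁻ x, ∫⁻ h, (‖F (x + h) - F x‖ₑ * K h) := by
          congr 1
          refine lintegral_congr fun x => ?_
          rw [← lintegral_add_left_eq_self _ x]
          simp
      _ = ENNReal.ofReal ((2 * L) ^ (p - 1)) * ∫⁻ h, ∫⁻ x, (‖F (x + h) - F x‖ₑ * K h) := by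
          congr 1
          refine lintegral_lintegral_swap (Measurable.aemeasurable ?_)
          have := hKm
          fun_prop
      _ ≤ _ := by
          gcongr
          calc ∫⁻ h, ∫⁻ x, (‖F (x + h) - F x‖ₑ * K h)
              ≤ ∫⁻ h, (Metric.ball (0 : Vec n) (2 * R)).indicator
                (fun h => B * ENNReal.ofReal (‖h‖ ^ ((θ - s * p) - n))) h := by
                refine lintegral_mono fun h => ?_
                rw [lintegral_mul_const _ (by fun_prop)]
                by_cases hh : h ∈ Metric.ball (0 : Vec n) (2 * R)
                · rw [hK, indicator_of_mem hh, indicator_of_mem hh]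
                  refine (mul_le_mul_left (hB h) _).trans ?_
                  rw [mul_assoc]
                  gcongr
                  rw [← ofReal_norm, ENNReal.ofReal_rpow_of_nonneg (norm_nonneg _) hθ0.le,
                    ← ENNReal.ofReal_mul (by positivity)]
                  refine ENNReal.ofReal_le_ofReal ?_
                  rcases eq_or_ne h 0 with rfl | h0
                  · rw [norm_zero, Real.zero_rpow hθ0.ne', zero_mul]
                    positivity
                  · rw [← Real.rpow_add (norm_pos_iff.2 h0)]
                    apply le_of_eq; congr 1; ring
                · rw [hK, indicator_of_notMem hh, mul_zero]
                  exact zero_le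
            _ = B * rieszIntegral n (θ - s * p) (2 * R) := by
                rw [lintegral_indicator measurableSet_ball, lintegral_const_mul _ (by fun_prop)]
                rfl
  rw [wspNorm]
  gcongr

/-- The constant in the Nikolskii estimate for a telescoping series. -/
def nikolskiiConst (a b τ Λ : ℝ≥0∞) (θ : ℝ) : ℝ≥0∞ :=
  (2 * a) ^ (1 - θ) * ((1 + Λ) * b) ^ θ * (1 - τ ^ (1 - θ) * Λ ^ θ)⁻¹

/-- If the increments of a sequence decay geometrically in `L¹`, and the variation of its members
grows geometrically, then the limit satisfies a Nikolskii estimate. -/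
lemma lintegral_translate_sub_le_of_tendsto {X E : Type*} [NormedAddCommGroup X]
    [MeasurableSpace X] [BorelSpace X] [SecondCountableTopology X] {μ : Measure X}
    [μ.IsAddRightInvariant] [NormedAddCommGroup E]
    [MeasurableSpace E] [BorelSpace E] [SecondCountableTopology E] {F : ℕ → X → E}
    {f : X → E} (hF : ∀ i, Measurable (F i)) (h0 : ∃ c, ∀ x, F 0 x = c)
    (hf : ∀ᵐ x ∂μ, Tendsto (fun i => F i x) atTop (𝓝 (f x))) {a b τ Λ : ℝ≥0∞} {θ : ℝ}
    (hθ : 0 < θ) (hθ1 : θ < 1) (hL : ∀ i, ∫⁻ x, ‖F (i + 1) x - F i x‖ₑ ∂μ ≤ a * τ ^ i)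
    (ht : ∀ i h, ∫⁻ x, ‖F i (x + h) - F i x‖ₑ ∂μ ≤ b * Λ ^ i * ‖h‖ₑ) (h : X) :
    ∫⁻ x, ‖f (x + h) - f x‖ₑ ∂μ ≤ nikolskiiConst a b τ Λ θ * ‖h‖ₑ ^ θ := by
  set g : ℕ → X → E := fun i x => F (i + 1) x - F i x with hg
  have hgm : ∀ i, Measurable (g i) := fun i => (hF _).sub (hF _)
  have hmp : MeasurePreserving (fun x => x + h) μ μ := measurePreserving_add_right μ h
  have hpt : ∀ᵐ x ∂μ, ‖f (x + h) - f x‖ₑ ≤ ∑' i, ‖g i (x + h) - g i x‖ₑ := by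
    filter_upwards [hf, hmp.quasiMeasurePreserving.ae hf] with x hx hx'
    refine le_of_tendsto ((hx'.sub hx).enorm) (Eventually.of_forall fun I => ?_)
    -- Telescoping; the constant `F 0` cancels in the difference.
    have : F I (x + h) - F I x = ∑ i ∈ Finset.range I, (g i (x + h) - g i x) := by
      obtain ⟨c, hc⟩ := h0
      rw [Finset.sum_sub_distrib]
      simp only [hg]
      rw [Finset.sum_range_sub (fun i => F i (x + h)), Finset.sum_range_sub (fun i => F i x)]
      simp [hc]
    rw [this]
    exact (enorm_sum_le _ _).trans (ENNReal.sum_le_tsum _)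
  have hterm : ∀ i, ∫⁻ x, ‖g i (x + h) - g i x‖ₑ ∂μ ≤
      ((2 * a) ^ (1 - θ) * ((1 + Λ) * b) ^ θ * ‖h‖ₑ ^ θ) * (τ ^ (1 - θ) * Λ ^ θ) ^ i := by
    intro i
    have h1 : ∫⁻ x, ‖g i (x + h) - g i x‖ₑ ∂μ ≤ 2 * a * τ ^ i := by
      calc _ ≤ ∫⁻ x, (‖g i (x + h)‖ₑ + ‖g i x‖ₑ) ∂μ := lintegral_mono fun x => enorm_sub_le
        _ = ∫⁻ x, ‖g i (x + h)‖ₑ ∂μ + ∫⁻ x, ‖g i x‖ₑ ∂μ :=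
            lintegral_add_right _ (hgm i).enorm
        _ ≤ a * τ ^ i + a * τ ^ i := by
            gcongr
            · rw [hmp.lintegral_comp (f := fun x => ‖g i x‖ₑ) (hgm i).enorm]
              exact hL i
            · exact hL i
        _ = _ := by ring
    have h2 : ∫⁻ x, ‖g i (x + h) - g i x‖ₑ ∂μ ≤ (1 + Λ) * b * Λ ^ i * ‖h‖ₑ := by
      calc _ ≤ ∫⁻ x, (‖F (i + 1) (x + h) - F (i + 1) x‖ₑ + ‖F i (x + h) - F i x‖ₑ) ∂μ := by
            refine lintegral_mono fun x => ?_
            have : g i (x + h) - g i x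
                = (F (i + 1) (x + h) - F (i + 1) x) - (F i (x + h) - F i x) := by
              simp only [hg]; abel
            rw [this]
            exact enorm_sub_le
        _ = ∫⁻ x, ‖F (i + 1) (x + h) - F (i + 1) x‖ₑ ∂μ + ∫⁻ x, ‖F i (x + h) - F i x‖ₑ ∂μ :=
            lintegral_add_right _ (((hF i).comp (measurable_add_const h)).sub (hF i)).enorm
        _ ≤ b * Λ ^ (i + 1) * ‖h‖ₑ + b * Λ ^ i * ‖h‖ₑ := add_le_add (ht _ _) (ht _ _)
        _ = _ := by ring
    have hθ' : 0 ≤ 1 - θ := by linarith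
    -- Interpolation: the decay bound is used with power `1 - θ`, the variation bound with power
    -- `θ`.
    calc _ = (∫⁻ x, ‖g i (x + h) - g i x‖ₑ ∂μ) ^ (1 - θ) *
          (∫⁻ x, ‖g i (x + h) - g i x‖ₑ ∂μ) ^ θ := by
          rw [← ENNReal.rpow_add_of_nonneg _ _ hθ' hθ.le]; simp
      _ ≤ (2 * a * τ ^ i) ^ (1 - θ) * ((1 + Λ) * b * Λ ^ i * ‖h‖ₑ) ^ θ := by gcongr
      _ = _ := by
          rw [ENNReal.mul_rpow_of_nonneg _ _ hθ', ENNReal.mul_rpow_of_nonneg _ _ hθ.le,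
            ENNReal.mul_rpow_of_nonneg _ (Λ ^ i) hθ.le, mul_pow, ← ENNReal.rpow_natCast,
            ← ENNReal.rpow_natCast, ← ENNReal.rpow_natCast, ← ENNReal.rpow_natCast,
            ← ENNReal.rpow_mul, ← ENNReal.rpow_mul, ← ENNReal.rpow_mul, ← ENNReal.rpow_mul,
            mul_comm (1 - θ), mul_comm θ]
          ring
  calc _ ≤ ∫⁻ x, ∑' i, ‖g i (x + h) - g i x‖ₑ ∂μ := lintegral_mono_ae hpt
    _ = ∑' i, ∫⁻ x, ‖g i (x + h) - g i x‖ₑ ∂μ := lintegral_tsum fun i =>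
        (((hgm i).comp (measurable_add_const h)).sub (hgm i)).enorm.aemeasurable
    _ ≤ ∑' i, ((2 * a) ^ (1 - θ) * ((1 + Λ) * b) ^ θ * ‖h‖ₑ ^ θ) * (τ ^ (1 - θ) * Λ ^ θ) ^ i :=
        ENNReal.tsum_le_tsum hterm
    _ = _ := by
        rw [ENNReal.tsum_mul_left, ENNReal.tsum_geometric, nikolskiiConst]
        ring

lemma nikolskiiConst_lt_top {a b τ Λ : ℝ≥0∞} {θ : ℝ} (hθ : 0 < θ) (hθ1 : θ < 1) (ha : a ≠ ⊤)
    (hb : b ≠ ⊤) (hΛ : Λ ≠ ⊤) (hq : τ ^ (1 - θ) * Λ ^ θ < 1) :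
    nikolskiiConst a b τ Λ θ < ⊤ := by
  rw [nikolskiiConst]
  refine ENNReal.mul_lt_top (ENNReal.mul_lt_top ?_ ?_) ?_
  · exact ENNReal.rpow_lt_top_of_nonneg (by linarith) (ENNReal.mul_ne_top (by simp) ha)
  · exact ENNReal.rpow_lt_top_of_nonneg hθ.le (ENNReal.mul_ne_top (by simp [hΛ]) hb)
  · rw [ENNReal.inv_lt_top]
    exact tsub_pos_of_lt hq

/-! ### Replacements -/

namespace Replacement

variable {n : ℕ} {𝒞 : Set (Set (Vec n))} {V : Set (Mat n)} {v₁ C₃ : ℝ} {M : Mat n}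
  {D : Set (Vec n)}

/-- The difference of a replacement and the affine map that it replaces, extended by zero. -/
def diff (r : Replacement 𝒞 V v₁ C₃ M D) : Vec n → Vec n :=
  D.indicator fun x => r.u x - matApply M x

lemma continuous_diff (r : Replacement 𝒞 V v₁ C₃ M D) : Continuous r.diff :=
  continuous_indicator (fun x hx => by rw [r.boundary x hx, sub_self])
    (r.continuousOn.sub (continuous_matApply M).continuousOn)

lemma diff_of_mem_piece (r : Replacement 𝒞 V v₁ C₃ M D) {i : Fin r.N} {x : Vec n}
    (hx : x ∈ r.piece i) : r.diff x = matApply (r.grad i) x + r.shift i - matApply M x := by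
  rw [diff, indicator_of_mem (r.piece_subset i hx), r.affine i x hx]

lemma diff_of_notMem (r : Replacement 𝒞 V v₁ C₃ M D) {x : Vec n} (hx : x ∉ D) : r.diff x = 0 :=
  indicator_of_notMem hx _

lemma diff_of_mem_bad (r : Replacement 𝒞 V v₁ C₃ M D) {i : Fin r.N} (hi : i ∉ r.good) {x : Vec n}
    (hx : x ∈ r.piece i) : r.diff x = 0 := by
  rw [diff, indicator_of_mem (r.piece_subset i hx), r.bad_eq i hi x hx, sub_self]

lemma sum_volume (h𝒞 : IsDomainClass 𝒞) (r : Replacement 𝒞 V v₁ C₃ M D) :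
    ∑ i, volume (r.piece i) = volume D := by
  rw [← tsum_fintype (L := .unconditional _), ← measure_iUnion (fun i j hij => r.disjoint i j hij)
    fun i => (h𝒞 _ (r.piece_mem i)).1.measurableSet]
  refine measure_congr (Filter.EventuallyLE.antisymm ?_ ?_)
  · exact (iUnion_subset r.piece_subset).eventuallyLE
  · exact ae_le_set.2 r.cover

lemma ae_mem (r : Replacement 𝒞 V v₁ C₃ M D) : ∀ᵐ x, x ∈ D → ∃ i, x ∈ r.piece i := by
  have := r.cover
  rw [measure_eq_zero_iff_ae_notMem] at this
  filter_upwards [this] with x hx hxD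
  by_contra h
  exact hx ⟨hxD, by simpa using h⟩

/-- The gradient of the replaced affine map is an average of the gradients of the replacement. -/
lemma matNorm_le (h𝒞 : IsDomainClass 𝒞) (hD : D ∈ 𝒞) (hne : D.Nonempty)
    (r : Replacement 𝒞 V v₁ C₃ M D) : matNorm M ≤ C₃ := by
  obtain ⟨hDo, hDb, -⟩ := h𝒞 D hD
  have hvol : volume D ≠ ⊤ := hDb.measure_lt_top.ne
  have hmeas : ∀ i, MeasurableSet (r.piece i) := fun i => (h𝒞 _ (r.piece_mem i)).1.measurableSet
  have hpvol : ∀ i, volume (r.piece i) ≠ ⊤ := fun i =>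
    ((measure_mono (r.piece_subset i)).trans_lt hvol.lt_top).ne
  set G : Vec n → Mat n := fun x a b => ∑ i, (r.piece i).indicator (fun _ => r.grad i a b - M a b) x
  -- `none` stands for the complement of `D`, where the extended difference vanishes.
  set S : Option (Fin r.N) → Set (Vec n) := fun o => o.elim Dᶜ r.piece
  set Mt : Option (Fin r.N) → Mat n := fun o => o.elim 0 fun i => r.grad i - M
  set b : Option (Fin r.N) → Vec n := fun o => o.elim 0 r.shift
  have hS : ∀ᵐ x, ∃ o, x ∈ S o := by
    filter_upwards [r.ae_mem] with x hx
    by_cases h : x ∈ D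
    · obtain ⟨i, hi⟩ := hx h
      exact ⟨some i, hi⟩
    · exact ⟨none, h⟩
  have haff : ∀ o, ∀ x ∈ S o, r.diff x = matApply (Mt o) x + b o := by
    rintro (_ | i) x hx
    · rw [r.diff_of_notMem hx]
      ext j; simp [Mt, b, matApply_apply]
    · rw [r.diff_of_mem_piece hx]
      simp only [Mt, b, Option.elim, matApply_sub_left]
      abel
  have hG : ∀ o, ∀ x ∈ S o, G x = Mt o := by
    rintro (_ | i) x hx <;> ext a b
    · refine Finset.sum_eq_zero fun i _ => indicator_of_notMem (fun h => hx (r.piece_subset i h)) _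
    · refine (Finset.sum_eq_single i (fun j _ hj => indicator_of_notMem (fun h => ?_) _)
        (by simp)).trans (indicator_of_mem hx _)
      exact Set.disjoint_left.1 (r.disjoint j i hj) h hx
  have hSm : ∀ o, MeasurableSet (S o) := by
    rintro (_ | i)
    · exact hDo.measurableSet.compl
    · exact hmeas i
  obtain ⟨L, hL⟩ : ∃ L, ∀ o, matNorm (Mt o) ≤ L :=
    ⟨∑ o, matNorm (Mt o), fun o => Finset.single_le_sum (f := fun o => matNorm (Mt o))
      (fun o _ => matNorm_nonneg _) (Finset.mem_univ o)⟩
  have hlip := lipschitzWith_of_piecewise_affine hL r.continuous_diff hS haff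
  have hfd := ae_hasFDerivAt_of_piecewise_affine hSm hlip hS haff hG
  have hcs : HasCompactSupport r.diff := HasCompactSupport.of_support_subset_isCompact
    hDb.isCompact_closure (support_indicator_subset.trans subset_closure)
  -- The extended difference has compact support, so its gradient has mean zero.
  have hzero : ∀ a b, ∑ i, (volume (r.piece i)).toReal * (r.grad i a b - M a b) = 0 := by
    intro a b
    rw [← integral_grad_eq_zero_of_lipschitz hlip hfd hcs a b, integral_finsetSum _ fun i _ =>
      (integrable_indicator_iff (hmeas i)).2 (integrableOn_const (hpvol i))]
    refine Finset.sum_congr rfl fun i _ => ?_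
    rw [integral_indicator_const _ (hmeas i), smul_eq_mul, Measure.real]
  have hsum : ∑ i, (volume (r.piece i)).toReal = (volume D).toReal := by
    rw [← r.sum_volume h𝒞, ENNReal.toReal_sum fun i _ => hpvol i]
  have hvec : (volume D).toReal • matVec M = ∑ i, (volume (r.piece i)).toReal • matVec (r.grad i) := by
    rw [← hsum, Finset.sum_smul, eq_comm, ← sub_eq_zero, ← Finset.sum_sub_distrib]
    ext q
    simpa [mul_sub] using hzero q.1 q.2
  have hpos : 0 < (volume D).toReal := ENNReal.toReal_pos (hDo.measure_pos volume hne).ne' hvol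
  refine le_of_mul_le_mul_left ?_ hpos
  calc (volume D).toReal * matNorm M = ‖(volume D).toReal • matVec M‖ := by
        rw [norm_smul, matNorm_eq, Real.norm_of_nonneg hpos.le]
    _ ≤ ∑ i, (volume (r.piece i)).toReal * C₃ := by
        rw [hvec]
        refine (norm_sum_le _ _).trans (Finset.sum_le_sum fun i _ => ?_)
        rw [norm_smul, ← matNorm_eq, Real.norm_of_nonneg ENNReal.toReal_nonneg]
        exact mul_le_mul_of_nonneg_left (r.grad_bound i) ENNReal.toReal_nonneg
    _ = (volume D).toReal * C₃ := by rw [← Finset.sum_mul, hsum]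

end Replacement

/-! ### Stages of the construction -/

/-- A stage of the convex integration scheme: a continuous map that is affine on finitely many
pieces that cover almost all of `Ω`, each with a level `l` and a gradient in `W l`. -/
structure Stage {n : ℕ} (𝒞 : Set (Set (Vec n))) (W : ℕ → Set (Mat n)) (M₀ : Mat n) (L : ℝ)
    (Ω : Set (Vec n)) where
  /-- the indices of the pieces -/
  ι : Type
  /-- there are finitely many pieces -/
  [fintype : Fintype ι]
  /-- the pieces -/
  piece : ι → Set (Vec n)
  /-- the gradient on a piece -/
  mat : ι → Mat n
  /-- the constant part on a piece -/
  shift : ι → Vec n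
  /-- the level of a piece -/
  level : ι → ℕ
  /-- the map -/
  u : Vec n → Vec n
  piece_mem : ∀ i, piece i ∈ 𝒞
  subset : ∀ i, piece i ⊆ Ω
  disjoint : ∀ i j, i ≠ j → Disjoint (piece i) (piece j)
  ae_mem : ∀ᵐ x, x ∈ Ω → ∃ i, x ∈ piece i
  mat_mem : ∀ i, mat i ∈ W (level i)
  mat_le : ∀ i, matNorm (mat i) ≤ L
  continuous_u : Continuous u
  affine : ∀ i, ∀ x ∈ piece i, u x = matApply (mat i) x + shift i
  off : ∀ x ∉ Ω, u x = matApply M₀ x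

namespace Stage

attribute [instance] Stage.fintype

variable {n : ℕ} {𝒞 : Set (Set (Vec n))} {W : ℕ → Set (Mat n)} {M₀ : Mat n} {L : ℝ}
  {Ω : Set (Vec n)}

lemma eq_of_mem (S : Stage 𝒞 W M₀ L Ω) {i j : S.ι} {x : Vec n} (hi : x ∈ S.piece i)
    (hj : x ∈ S.piece j) : i = j := by
  by_contra h
  exact Set.disjoint_left.1 (S.disjoint i j h) hi hj

/-- The gradient of the map of a stage. -/
def grad (S : Stage 𝒞 W M₀ L Ω) (x : Vec n) : MatVec n :=
  matVec M₀ + ∑ i, (S.piece i).indicator (fun _ => matVec (S.mat i) - matVec M₀) x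

lemma sum_indicator {E : Type*} [AddCommMonoid E] (S : Stage 𝒞 W M₀ L Ω) (f : S.ι → Vec n → E)
    {i : S.ι} {x : Vec n} (hx : x ∈ S.piece i) :
    ∑ i, (S.piece i).indicator (f i) x = f i x :=
  (Finset.sum_eq_single i (fun j _ hj => indicator_of_notMem
    (fun h => hj (S.eq_of_mem h hx)) _) (by simp)).trans (indicator_of_mem hx _)

lemma sum_indicator_of_notMem {E : Type*} [AddCommMonoid E] (S : Stage 𝒞 W M₀ L Ω)
    (f : S.ι → Vec n → E) {x : Vec n} (hx : x ∉ Ω) : ∑ i, (S.piece i).indicator (f i) x = 0 :=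
  Finset.sum_eq_zero fun i _ => indicator_of_notMem (fun h => hx (S.subset i h)) _

lemma grad_of_mem (S : Stage 𝒞 W M₀ L Ω) {i : S.ι} {x : Vec n} (hx : x ∈ S.piece i) :
    S.grad x = matVec (S.mat i) := by
  rw [grad, S.sum_indicator (fun i _ => matVec (S.mat i) - matVec M₀) hx]
  abel

lemma grad_of_notMem (S : Stage 𝒞 W M₀ L Ω) {x : Vec n} (hx : x ∉ Ω) :
    S.grad x = matVec M₀ := by
  rw [grad, S.sum_indicator_of_notMem _ hx, add_zero]

lemma measurableSet_piece (h𝒞 : IsDomainClass 𝒞) (S : Stage 𝒞 W M₀ L Ω) (i : S.ι) :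
    MeasurableSet (S.piece i) := (h𝒞 _ (S.piece_mem i)).1.measurableSet

lemma measurable_grad (h𝒞 : IsDomainClass 𝒞) (S : Stage 𝒞 W M₀ L Ω) : Measurable S.grad :=
  measurable_const.add (Finset.measurable_fun_sum _ fun i _ =>
    measurable_const.indicator (S.measurableSet_piece h𝒞 i))

lemma ae_norm_grad_le (hM₀ : matNorm M₀ ≤ L) (S : Stage 𝒞 W M₀ L Ω) :
    ∀ᵐ x, ‖S.grad x‖ ≤ L := by
  filter_upwards [S.ae_mem] with x hx
  by_cases h : x ∈ Ω
  · obtain ⟨i, hi⟩ := hx h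
    rw [S.grad_of_mem hi, ← matNorm_eq]
    exact S.mat_le i
  · rwa [S.grad_of_notMem h, ← matNorm_eq]

lemma ae_mem_cover (S : Stage 𝒞 W M₀ L Ω) :
    ∀ᵐ x, ∃ o : Option S.ι, x ∈ (o.elim Ωᶜ S.piece : Set (Vec n)) := by
  filter_upwards [S.ae_mem] with x hx
  by_cases h : x ∈ Ω
  · obtain ⟨i, hi⟩ := hx h
    exact ⟨some i, hi⟩
  · exact ⟨none, h⟩

lemma affine_cover (S : Stage 𝒞 W M₀ L Ω) (o : Option S.ι) :
    ∀ x ∈ (o.elim Ωᶜ S.piece : Set (Vec n)),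
      S.u x = matApply (o.elim M₀ S.mat) x + o.elim 0 S.shift := by
  intro x hx
  cases o with
  | none => simpa using S.off x hx
  | some i => exact S.affine i x hx

lemma lipschitzWith_u (hM₀ : matNorm M₀ ≤ L) (S : Stage 𝒞 W M₀ L Ω) :
    LipschitzWith L.toNNReal S.u := by
  refine lipschitzWith_of_piecewise_affine (M := fun o : Option S.ι => o.elim M₀ S.mat) ?_
    S.continuous_u S.ae_mem_cover S.affine_cover
  rintro (_ | i)
  · exact hM₀
  · exact S.mat_le i

lemma ae_hasFDerivAt_u (h𝒞 : IsDomainClass 𝒞) (hΩ : Ω ∈ 𝒞) (hM₀ : matNorm M₀ ≤ L)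
    (S : Stage 𝒞 W M₀ L Ω) : ∀ᵐ x, HasFDerivAt S.u (matCLM (vecMat (S.grad x))) x := by
  refine ae_hasFDerivAt_of_piecewise_affine ?_ (S.lipschitzWith_u hM₀) S.ae_mem_cover
    S.affine_cover ?_
  · rintro (_ | i)
    · exact (h𝒞 _ hΩ).1.measurableSet.compl
    · exact S.measurableSet_piece h𝒞 i
  · rintro (_ | i) x hx
    · rw [S.grad_of_notMem hx]; rfl
    · rw [S.grad_of_mem hx]; rfl

/-- The gradient is `M₀` plus a combination of indicators of pieces with coefficients of norm at
most `2L`, so its translates are controlled by the perimeters. -/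
lemma lintegral_translate_sub_grad_le (h𝒞 : IsDomainClass 𝒞) (hM₀ : matNorm M₀ ≤ L)
    (S : Stage 𝒞 W M₀ L Ω) (h : Vec n) : ∫⁻ x, ‖S.grad (x + h) - S.grad x‖ₑ ≤
      ENNReal.ofReal (2 * L) * (∑ i, perimeter (S.piece i)) * ‖h‖ₑ := by
  set χ : S.ι → Vec n → ℝ := fun i => (S.piece i).indicator fun _ => 1 with hχ
  have hχm : ∀ i, Measurable (χ i) := fun i =>
    measurable_const.indicator (S.measurableSet_piece h𝒞 i)
  have hpt : ∀ x, ‖S.grad (x + h) - S.grad x‖ₑ ≤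
      ∑ i, ENNReal.ofReal (2 * L) * ‖χ i (x + h) - χ i x‖ₑ := by
    intro x
    have : S.grad (x + h) - S.grad x =
        ∑ i, (χ i (x + h) - χ i x) • (matVec (S.mat i) - matVec M₀) := by
      simp only [grad, add_sub_add_left_eq_sub, ← Finset.sum_sub_distrib, sub_smul]
      refine Finset.sum_congr rfl fun i _ => ?_
      congr 1
      · by_cases h1 : x + h ∈ S.piece i <;> simp [χ, h1]
      · by_cases h1 : x ∈ S.piece i <;> simp [χ, h1]
    rw [this]
    refine (enorm_sum_le _ _).trans (Finset.sum_le_sum fun i _ => ?_)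
    rw [enorm_smul, mul_comm]
    gcongr
    rw [← ofReal_norm]
    refine ENNReal.ofReal_le_ofReal ((norm_sub_le _ _).trans ?_)
    rw [← matNorm_eq, ← matNorm_eq]
    linarith [S.mat_le i]
  calc _ ≤ ∫⁻ x, ∑ i, ENNReal.ofReal (2 * L) * ‖χ i (x + h) - χ i x‖ₑ := lintegral_mono hpt
    _ = ∑ i, ENNReal.ofReal (2 * L) * ∫⁻ x, ‖χ i (x + h) - χ i x‖ₑ := by
        rw [lintegral_finsetSum _ fun i _ => ?_]
        · simp only [lintegral_const_mul' _ _ ENNReal.ofReal_ne_top]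
        · exact ((((hχm i).comp (measurable_add_const h)).sub (hχm i)).enorm).const_mul _
    _ ≤ ∑ i, ENNReal.ofReal (2 * L) * (‖h‖ₑ * perimeter (S.piece i)) := by
        gcongr with i
        obtain ⟨h1, h2, h3⟩ := h𝒞 _ (S.piece_mem i)
        exact lintegral_indicator_translate_sub_le h1 h2 h3 h
    _ = _ := by
        rw [← Finset.mul_sum, ← Finset.mul_sum]
        ring

/-- The weighted volume of a stage. -/
def mass (S : Stage 𝒞 W M₀ L Ω) (μ : ℝ≥0∞) : ℝ≥0∞ := ∑ i, μ ^ S.level i * volume (S.piece i)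

/-- The weighted perimeter of a stage. -/
def weightedPerimeter (S : Stage 𝒞 W M₀ L Ω) (wt : ℕ → Mat n → Set (Vec n) → ℝ≥0∞) : ℝ≥0∞ :=
  ∑ i, wt (S.level i) (S.mat i) (S.piece i) * perimeter (S.piece i)

end Stage

/-! ### Refinement of stages -/

/-- Replacements are available at every level, with a weighted perimeter that grows at most by the
factor `Λ`, increments bounded in `L¹` by `κ μ^l`, and weighted volumes that decay by the
factor `τ`. -/
def HasSteps {n : ℕ} (𝒞 : Set (Set (Vec n))) (W : ℕ → Set (Mat n)) (v₁ C₃ : ℝ)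
    (wt : ℕ → Mat n → Set (Vec n) → ℝ≥0∞) (Λ κ μ τ : ℝ≥0∞) : Prop :=
  ∀ l, ∀ M ∈ W l, ∀ D ∈ 𝒞, ∃ r : Replacement 𝒞 (W (l + 1)) v₁ C₃ M D,
    ((∑ i ∈ r.good, wt (l + 1) (r.grad i) (r.piece i) * perimeter (r.piece i)) +
      ∑ i ∈ r.goodᶜ, wt l M (r.piece i) * perimeter (r.piece i) ≤
        Λ * (wt l M D * perimeter D)) ∧
    (∑ i ∈ r.good, ‖matVec (r.grad i) - matVec M‖ₑ * volume (r.piece i) ≤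
      κ * (μ ^ l * volume D)) ∧
    (μ * (∑ i ∈ r.good, volume (r.piece i)) + ∑ i ∈ r.goodᶜ, volume (r.piece i) ≤ τ * volume D)

namespace Stage

variable {n : ℕ} {𝒞 : Set (Set (Vec n))} {W : ℕ → Set (Mat n)} {M₀ : Mat n} {L : ℝ}
  {Ω : Set (Vec n)}

/-- `S'` refines `S`, with estimates. -/
structure Refines (S' S : Stage 𝒞 W M₀ L Ω) (wt : ℕ → Mat n → Set (Vec n) → ℝ≥0∞)
    (Λ κ μ τ : ℝ≥0∞) : Prop where
  parent : ∀ e, ∃ i, S'.piece e ⊆ S.piece i ∧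
    (S'.level e = S.level i + 1 ∨ S'.level e = S.level i)
  perimeter_le : S'.weightedPerimeter wt ≤ Λ * S.weightedPerimeter wt
  mass_le : S'.mass μ ≤ τ * S.mass μ
  lintegral_le : ∫⁻ x, ‖S'.grad x - S.grad x‖ₑ ≤ κ * S.mass μ

/-- The stage in which each piece is split according to a replacement. -/
def next (S : Stage 𝒞 W M₀ L Ω) {v₁ C₃ : ℝ} (hC₃ : C₃ ≤ L)
    (r : ∀ i, Replacement 𝒞 (W (S.level i + 1)) v₁ C₃ (S.mat i) (S.piece i)) :
    Stage 𝒞 W M₀ L Ω where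
  ι := Σ i, Fin (r i).N
  piece e := (r e.1).piece e.2
  mat e := if e.2 ∈ (r e.1).good then (r e.1).grad e.2 else S.mat e.1
  shift e := if e.2 ∈ (r e.1).good then (r e.1).shift e.2 + S.shift e.1 else S.shift e.1
  level e := if e.2 ∈ (r e.1).good then S.level e.1 + 1 else S.level e.1
  u x := S.u x + ∑ i, (r i).diff x
  piece_mem e := (r e.1).piece_mem e.2
  subset e := ((r e.1).piece_subset e.2).trans (S.subset e.1)
  disjoint := by
    rintro ⟨i, e⟩ ⟨j, f⟩ h
    rcases eq_or_ne i j with rfl | hij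
    · exact (r i).disjoint e f fun hef => h (by rw [hef])
    · exact (S.disjoint i j hij).mono ((r i).piece_subset e) ((r j).piece_subset f)
  ae_mem := by
    filter_upwards [S.ae_mem, eventually_countable_forall.2 fun i => (r i).ae_mem] with x hx h hxΩ
    obtain ⟨i, hi⟩ := hx hxΩ
    obtain ⟨e, he⟩ := h i hi
    exact ⟨⟨i, e⟩, he⟩
  mat_mem e := by
    by_cases h : e.2 ∈ (r e.1).good
    · simpa only [if_pos h] using (r e.1).good_grad e.2 h
    · simpa only [if_neg h] using S.mat_mem e.1
  mat_le e := by
    by_cases h : e.2 ∈ (r e.1).good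
    · simpa only [if_pos h] using ((r e.1).grad_bound e.2).trans hC₃
    · simpa only [if_neg h] using S.mat_le e.1
  continuous_u := S.continuous_u.add (continuous_finsetSum _ fun i _ => (r i).continuous_diff)
  affine := by
    rintro ⟨i, e⟩ x hx
    have hxi : x ∈ S.piece i := (r i).piece_subset e hx
    have hsum : ∑ j, (r j).diff x = (r i).diff x :=
      Finset.sum_eq_single i (fun j _ hj => (r j).diff_of_notMem
        fun h => hj (S.eq_of_mem h hxi)) (by simp)
    rw [hsum, S.affine i x hxi]
    by_cases h : e ∈ (r i).good
    · simp only [if_pos h]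
      rw [(r i).diff_of_mem_piece hx]
      abel
    · simp only [if_neg h]
      rw [(r i).diff_of_mem_bad h hx, add_zero]
  off x hx := by
    rw [S.off x hx, Finset.sum_eq_zero, add_zero]
    exact fun i _ => (r i).diff_of_notMem fun h => hx (S.subset i h)

/-- All pieces are split simultaneously, and the three one-piece estimates of `HasSteps` are summed
over the old pieces; each new sum separates into good and bad parts. -/
lemma exists_refines (h𝒞 : IsDomainClass 𝒞) {v₁ C₃ : ℝ} (hC₃ : C₃ ≤ L)
    {wt : ℕ → Mat n → Set (Vec n) → ℝ≥0∞} {Λ κ μ τ : ℝ≥0∞}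
    (hW : HasSteps 𝒞 W v₁ C₃ wt Λ κ μ τ) (S : Stage 𝒞 W M₀ L Ω) :
    ∃ S' : Stage 𝒞 W M₀ L Ω, S'.Refines S wt Λ κ μ τ := by
  choose r hr₁ hr₂ hr₃ using fun i => hW (S.level i) (S.mat i) (S.mat_mem i) (S.piece i)
    (S.piece_mem i)
  refine ⟨S.next hC₃ r, ?_, ?_, ?_, ?_⟩
  · intro e
    refine ⟨e.1, (r e.1).piece_subset e.2, ?_⟩
    by_cases h : e.2 ∈ (r e.1).good <;> simp [next, h]
  · rw [weightedPerimeter, weightedPerimeter, Finset.mul_sum]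
    refine (Fintype.sum_sigma _).le.trans (Finset.sum_le_sum fun i _ => le_trans (le_of_eq ?_) (hr₁ i))
    rw [← Finset.sum_add_sum_compl (r i).good]
    congr 1
    · refine Finset.sum_congr rfl fun e he => ?_
      simp only [next, if_pos he]
    · refine Finset.sum_congr rfl fun e he => ?_
      simp only [next, if_neg (Finset.mem_compl.1 he)]
  · rw [mass, mass, Finset.mul_sum]
    refine (Fintype.sum_sigma _).le.trans (Finset.sum_le_sum fun i _ => ?_)
    have h := mul_le_mul_right (hr₃ i) (μ ^ S.level i)
    refine le_trans (le_of_eq ?_) (h.trans (le_of_eq ?_))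
    · rw [← Finset.sum_add_sum_compl (r i).good, mul_add, ← mul_assoc, ← pow_succ,
        Finset.mul_sum, Finset.mul_sum]
      congr 1
      · refine Finset.sum_congr rfl fun e he => ?_
        simp only [next, if_pos he]
      · refine Finset.sum_congr rfl fun e he => ?_
        simp only [next, if_neg (Finset.mem_compl.1 he)]
    · ring
  -- Only good pieces contribute, since bad pieces keep the old gradient.
  · have hpt : ∀ᵐ x, ‖(S.next hC₃ r).grad x - S.grad x‖ₑ ≤
        ∑ i, ∑ e ∈ (r i).good, ((r i).piece e).indicator
          (fun _ => ‖matVec ((r i).grad e) - matVec (S.mat i)‖ₑ) x := by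
      filter_upwards [(S.next hC₃ r).ae_mem] with x hx
      by_cases hxΩ : x ∈ Ω
      · obtain ⟨⟨i, e⟩, he⟩ := hx hxΩ
        have hxi : x ∈ S.piece i := (r i).piece_subset e he
        rw [grad_of_mem _ he, grad_of_mem _ hxi]
        by_cases h : e ∈ (r i).good
        · simp only [next, if_pos h]
          calc ‖matVec ((r i).grad e) - matVec (S.mat i)‖ₑ
              = ((r i).piece e).indicator
                (fun _ => ‖matVec ((r i).grad e) - matVec (S.mat i)‖ₑ) x :=
                by rw [indicator_of_mem]; exact he
            _ ≤ ∑ e ∈ (r i).good, ((r i).piece e).indicator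
                (fun _ => ‖matVec ((r i).grad e) - matVec (S.mat i)‖ₑ) x :=
                Finset.single_le_sum_of_canonicallyOrdered (f := fun e => ((r i).piece e).indicator
                (fun _ => ‖matVec ((r i).grad e) - matVec (S.mat i)‖ₑ) x) h
            _ ≤ _ := Finset.single_le_sum_of_canonicallyOrdered
                (f := fun i => ∑ e ∈ (r i).good, ((r i).piece e).indicator
                (fun _ => ‖matVec ((r i).grad e) - matVec (S.mat i)‖ₑ) x) (Finset.mem_univ i)
        · simp [next, h]
      · rw [grad_of_notMem _ hxΩ, grad_of_notMem _ hxΩ]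
        simp
    have hm : ∀ i e, MeasurableSet ((r i).piece e) := fun i e =>
      (h𝒞 _ ((r i).piece_mem e)).1.measurableSet
    refine (lintegral_mono_ae hpt).trans ?_
    rw [lintegral_finsetSum _ fun i _ => Finset.measurable_fun_sum _ fun e _ =>
      measurable_const.indicator (hm i e), mass, Finset.mul_sum]
    refine Finset.sum_le_sum fun i _ => ?_
    rw [lintegral_finsetSum _ fun e _ => measurable_const.indicator (hm i e)]
    refine le_trans (le_of_eq ?_) (hr₂ i)
    exact Finset.sum_congr rfl fun e _ => lintegral_indicator_const (hm i e) _

/-- The stage that consists of `Ω` and the affine map. -/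
def initial (hΩ : Ω ∈ 𝒞) {l₀ : ℕ} (hM₀ : M₀ ∈ W l₀) (hL : matNorm M₀ ≤ L) :
    Stage 𝒞 W M₀ L Ω where
  ι := Unit
  piece _ := Ω
  mat _ := M₀
  shift _ := 0
  level _ := l₀
  u := matApply M₀
  piece_mem _ := hΩ
  subset _ := subset_rfl
  disjoint i j h := absurd (Subsingleton.elim i j) h
  ae_mem := Eventually.of_forall fun _ hx => ⟨(), hx⟩
  mat_mem _ := hM₀
  mat_le _ := hL
  continuous_u := continuous_matApply M₀
  affine _ _ _ := (add_zero _).symm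
  off _ _ := rfl

lemma weightedPerimeter_initial (hΩ : Ω ∈ 𝒞) {l₀ : ℕ} (hM₀ : M₀ ∈ W l₀) (hL : matNorm M₀ ≤ L)
    (wt : ℕ → Mat n → Set (Vec n) → ℝ≥0∞) :
    (initial hΩ hM₀ hL).weightedPerimeter wt = wt l₀ M₀ Ω * perimeter Ω := by
  change ∑ _ : Unit, wt l₀ M₀ Ω * perimeter Ω = _
  simp

lemma mass_initial (hΩ : Ω ∈ 𝒞) {l₀ : ℕ} (hM₀ : M₀ ∈ W l₀) (hL : matNorm M₀ ≤ L) (μ : ℝ≥0∞) :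
    (initial hΩ hM₀ hL).mass μ = μ ^ l₀ * volume Ω := by
  change ∑ _ : Unit, μ ^ l₀ * volume Ω = _
  simp

end Stage

/-! ### Passage to the limit -/

lemma ae_exists_tendsto_of_tsum_lintegral_ne_top {X E : Type*} [MeasurableSpace X] {μ : Measure X}
    [NormedAddCommGroup E] [CompleteSpace E] [MeasurableSpace E] [BorelSpace E]
    [SecondCountableTopology E] {F : ℕ → X → E} (hF : ∀ i, Measurable (F i))
    (h : ∑' i, ∫⁻ x, ‖F (i + 1) x - F i x‖ₑ ∂μ ≠ ⊤) :
    ∀ᵐ x ∂μ, ∃ l, Tendsto (fun i => F i x) atTop (𝓝 l) := by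
  have hm : ∀ i, Measurable fun x => ‖F (i + 1) x - F i x‖ₑ := fun i => ((hF _).sub (hF _)).enorm
  rw [← lintegral_tsum fun i => (hm i).aemeasurable] at h
  filter_upwards [ae_lt_top (Measurable.tsum hm) h] with x hx
  refine cauchySeq_tendsto_of_complete
    (cauchySeq_of_edist_le_of_tsum_ne_top (fun i => ‖F (i + 1) x - F i x‖ₑ) (fun i => ?_) hx.ne)
  rw [edist_comm, edist_eq_enorm_sub]

/-- Dominated convergence against each test function: `β` is bounded on its support, and the
gradients are uniformly bounded. -/
lemma hasWeakGradient_of_tendsto {n : ℕ} {u : ℕ → Vec n → Vec n} {F : ℕ → Vec n → MatVec n}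
    {v : Vec n → Vec n} {G : Vec n → MatVec n} (h : ∀ i, HasWeakGradient (u i) fun x => vecMat (F i x))
    (hv : Measurable v) (hG : Measurable G) (hu : ∀ i, Measurable (u i)) (hF : ∀ i, Measurable (F i))
    (huv : ∀ᵐ x, Tendsto (fun i => u i x) atTop (𝓝 (v x)))
    (hFG : ∀ᵐ x, Tendsto (fun i => F i x) atTop (𝓝 (G x)))
    {β : Vec n → ℝ} (hβ : Continuous β) (hub : ∀ i, ∀ᵐ x, ‖u i x‖ ≤ β x)
    {L : ℝ} (hFb : ∀ i, ∀ᵐ x, ‖F i x‖ ≤ L) : HasWeakGradient v fun x => vecMat (G x) := by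
  have hvb : ∀ᵐ x, ‖v x‖ ≤ β x := by
    filter_upwards [huv, eventually_countable_forall.2 hub] with x h1 h2
    exact le_of_tendsto' h1.norm h2
  have hGb : ∀ᵐ x, ‖G x‖ ≤ L := by
    filter_upwards [hFG, eventually_countable_forall.2 hFb] with x h1 h2
    exact le_of_tendsto' h1.norm h2
  refine ⟨fun i => ?_, fun i j => ?_, fun φ hφ hφc i j => ?_⟩
  · refine hβ.locallyIntegrable.mono (by fun_prop) ?_
    filter_upwards [hvb] with x hx
    exact (PiLp.norm_apply_le _ _).trans (hx.trans (le_abs_self _))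
  · refine (continuous_const (y := L)).locallyIntegrable.mono
      (by simp only [vecMat_apply]; fun_prop) ?_
    filter_upwards [hGb] with x hx
    exact (PiLp.norm_apply_le _ _).trans (hx.trans (le_abs_self _))
  · have hφ' : Continuous fun x => fderiv ℝ φ x (EuclideanSpace.single j 1) :=
      (hφ.continuous_fderiv (by simp)).clm_apply continuous_const
    have hφ'c : HasCompactSupport fun x => fderiv ℝ φ x (EuclideanSpace.single j 1) :=
      (hφc.fderiv (𝕜 := ℝ)).comp_left
        (g := fun A : Vec n →L[ℝ] ℝ => A (EuclideanSpace.single j 1)) rfl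
    have h1 : Tendsto (fun k => ∫ x, u k x i * fderiv ℝ φ x (EuclideanSpace.single j 1)) atTop
        (𝓝 (∫ x, v x i * fderiv ℝ φ x (EuclideanSpace.single j 1))) := by
      refine tendsto_integral_of_dominated_convergence
        (fun x => β x * ‖fderiv ℝ φ x (EuclideanSpace.single j 1)‖) (fun k => ?_) ?_ (fun k => ?_) ?_
      · have := hu k
        exact (Measurable.aestronglyMeasurable (by fun_prop)).mul hφ'.aestronglyMeasurable
      · exact (hβ.mul hφ'.norm).integrable_of_hasCompactSupport hφ'c.norm.mul_left
      · filter_upwards [hub k] with x hx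
        rw [norm_mul]
        gcongr
        exact (PiLp.norm_apply_le _ _).trans hx
      · filter_upwards [huv] with x hx
        exact (((EuclideanSpace.proj (𝕜 := ℝ) i).continuous.tendsto _).comp hx).mul_const _
    have h2 : Tendsto (fun k => -∫ x, F k x (i, j) * φ x) atTop (𝓝 (-∫ x, G x (i, j) * φ x)) := by
      refine (tendsto_integral_of_dominated_convergence
        (fun x => L * ‖φ x‖) (fun k => ?_) ?_ (fun k => ?_) ?_).neg
      · have := hF k
        exact (Measurable.aestronglyMeasurable (by fun_prop)).mul hφ.continuous.aestronglyMeasurable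
      · exact (continuous_const.mul hφ.continuous.norm).integrable_of_hasCompactSupport
          hφc.norm.mul_left
      · filter_upwards [hFb k] with x hx
        rw [norm_mul]
        gcongr
        exact (PiLp.norm_apply_le _ _).trans hx
      · filter_upwards [hFG] with x hx
        exact (((EuclideanSpace.proj (𝕜 := ℝ) (i, j)).continuous.tendsto _).comp hx).mul_const _
    refine tendsto_nhds_unique h1 (h2.congr fun k => ?_)
    exact ((h k).integral_eq φ hφ hφc i j).symm

/-- The limit condition of an in-approximation asks for one matrix in each late set, so every late
level must be attained. Steps of size at most one skip no level, and `lev i ≤ lev 0 + i` sends the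
chosen indices to infinity. -/
lemma exists_index_of_level {lev : ℕ → ℕ}
    (hstep : ∀ i, lev (i + 1) = lev i + 1 ∨ lev (i + 1) = lev i) (hunb : ∀ l, ∃ i, l ≤ lev i) :
    ∃ idx : ℕ → ℕ, (∀ l, lev 0 ≤ l → lev (idx l) = l) ∧ Tendsto idx atTop atTop := by
  have hle : ∀ i, lev i ≤ lev 0 + i := by
    intro i
    induction i with
    | zero => simp
    | succ i ih => rcases hstep i with h | h <;> omega
  have hex : ∀ l, lev 0 ≤ l → ∃ i, lev i = l := by
    intro l hl
    classical
    set i := Nat.find (hunb l) with hi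
    have h1 : l ≤ lev i := Nat.find_spec (hunb l)
    rcases Nat.eq_zero_or_pos i with h0 | h0
    · exact ⟨0, le_antisymm hl (h0 ▸ h1)⟩
    · obtain ⟨k, hk⟩ : ∃ k, i = k + 1 := ⟨i - 1, by omega⟩
      have h2 : ¬ l ≤ lev k := Nat.find_min (hunb l) (by omega)
      refine ⟨i, ?_⟩
      rw [hk] at h1 ⊢
      rcases hstep k with h | h <;> omega
  choose! idx hidx using hex
  refine ⟨idx, hidx, tendsto_atTop_mono' (f₁ := fun l => l - lev 0) _ ?_
    (tendsto_sub_atTop_nat _)⟩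
  filter_upwards [eventually_ge_atTop (lev 0)] with l hl
  have := hle (idx l)
  rw [hidx l hl] at this
  omega

/-- The limit of a sequence of stages. -/
theorem exists_limit_of_hasSteps {n : ℕ} (hn : 1 ≤ n) {𝒞 : Set (Set (Vec n))}
    (h𝒞 : IsDomainClass 𝒞) {Ω : Set (Vec n)} (hΩ : Ω ∈ 𝒞) {W : ℕ → Set (Mat n)} {K : Set (Mat n)}
    (hK : ∀ (V : ℕ → Mat n) (V' : Mat n),
      (∀ᶠ i in atTop, V i ∈ W i) → Tendsto V atTop (𝓝 V') → V' ∈ K)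
    {v₁ C₃ L : ℝ} (hC₃ : C₃ ≤ L) {M₀ : Mat n} (hL : matNorm M₀ ≤ L) {l₀ : ℕ} (hM₀ : M₀ ∈ W l₀)
    {wt : ℕ → Mat n → Set (Vec n) → ℝ≥0∞} (hwt : ∀ l M D, 1 ≤ wt l M D) {Λ κ μ τ : ℝ≥0∞}
    (hκ : κ ≠ ⊤) (hμ : μ ≠ 0) (hμ1 : μ < 1) (hτ : τ < 1)
    (hW : HasSteps 𝒞 W v₁ C₃ wt Λ κ μ τ) {θ : ℝ} (hθ : 0 < θ) (hθ1 : θ < 1) :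
    ∃ (u : Vec n → Vec n) (F : Vec n → MatVec n), Measurable F ∧
      MemW1InftyLoc u (fun x => vecMat (F x)) ∧ (∀ᵐ x, x ∈ Ω → vecMat (F x) ∈ K) ∧
      (∀ᵐ x, x ∉ Ω → vecMat (F x) = M₀) ∧ (∀ᵐ x, ‖F x‖ ≤ L) ∧
      ∀ h, ∫⁻ x, ‖F (x + h) - F x‖ₑ ≤ nikolskiiConst (κ * volume Ω)
        (ENNReal.ofReal (2 * L) * (wt l₀ M₀ Ω * perimeter Ω)) τ Λ θ * ‖h‖ₑ ^ θ := by
  obtain ⟨hΩo, hΩb, hΩp⟩ := h𝒞 Ω hΩ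
  have hvol : volume Ω ≠ ⊤ := hΩb.measure_lt_top.ne
  have hL0 : 0 ≤ L := (matNorm_nonneg _).trans hL
  choose nxt hnxt using fun S : Stage 𝒞 W M₀ L Ω => S.exists_refines h𝒞 hC₃ hW
  let S : ℕ → Stage 𝒞 W M₀ L Ω := fun i => nxt^[i] (Stage.initial hΩ hM₀ hL)
  have hS : ∀ i, (S (i + 1)).Refines (S i) wt Λ κ μ τ := fun i => by
    simp only [S, Function.iterate_succ_apply']
    exact hnxt _
  have hper : ∀ i, ∑ e, perimeter ((S i).piece e) ≤ (wt l₀ M₀ Ω * perimeter Ω) * Λ ^ i := by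
    have h1 : ∀ i, (S i).weightedPerimeter wt ≤ (wt l₀ M₀ Ω * perimeter Ω) * Λ ^ i := by
      intro i
      induction i with
      | zero => simp [S, Stage.weightedPerimeter_initial]
      | succ i ih =>
        refine (hS i).perimeter_le.trans ((mul_le_mul_right ih Λ).trans (le_of_eq ?_))
        ring
    refine fun i => le_trans (Finset.sum_le_sum fun e _ => ?_) (h1 i)
    exact le_mul_of_one_le_left zero_le (hwt _ _ _)
  have hmass : ∀ i, (S i).mass μ ≤ volume Ω * τ ^ i := by
    intro i
    induction i with
    | zero =>
      rw [pow_zero, mul_one]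
      refine (Stage.mass_initial hΩ hM₀ hL μ).le.trans ?_
      exact mul_le_of_le_one_left zero_le (pow_le_one₀ zero_le hμ1.le)
    | succ i ih =>
      refine (hS i).mass_le.trans ((mul_le_mul_right ih τ).trans (le_of_eq ?_))
      ring
  have hincr : ∀ i, ∫⁻ x, ‖(S (i + 1)).grad x - (S i).grad x‖ₑ ≤ κ * volume Ω * τ ^ i := fun i =>
    (hS i).lintegral_le.trans ((mul_le_mul_right (hmass i) κ).trans (le_of_eq (by ring)))
  have hgeom : ∀ c : ℝ≥0∞, c ≠ ⊤ → ∑' i : ℕ, c * τ ^ i ≠ ⊤ := by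
    intro c hc
    rw [ENNReal.tsum_mul_left, ENNReal.tsum_geometric]
    refine ENNReal.mul_ne_top hc ?_
    rw [ENNReal.inv_ne_top]
    exact (tsub_pos_of_lt hτ).ne'
  have hκv : κ * volume Ω ≠ ⊤ := ENNReal.mul_ne_top hκ hvol
  have hgm : ∀ i, Measurable (S i).grad := fun i => (S i).measurable_grad h𝒞
  have hum : ∀ i, Measurable (S i).u := fun i => (S i).continuous_u.measurable
  -- convergence of the gradients
  obtain ⟨F, hFm, hF⟩ := measurable_limit_of_tendsto_metrizable_ae (fun i => (hgm i).aemeasurable)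
    (ae_exists_tendsto_of_tsum_lintegral_ne_top (μ := volume) hgm
      (ne_top_of_le_ne_top (hgeom _ hκv) (ENNReal.tsum_le_tsum hincr)))
  -- convergence of the maps
  obtain ⟨R, hR⟩ := hΩb.subset_closedBall 0
  have hoff : ∀ i x, R < ‖x‖ → (S (i + 1)).u x - (S i).u x = 0 := by
    intro i x hx
    have : x ∉ Ω := fun h => by
      have := hR h
      rw [mem_closedBall_zero_iff] at this
      linarith
    rw [(S _).off x this, (S _).off x this, sub_self]
  have hlip : ∀ i, LipschitzWith L.toNNReal (S i).u := fun i => (S i).lipschitzWith_u hL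
  have hfd : ∀ i, ∀ᵐ x, HasFDerivAt (S i).u (matCLM (vecMat ((S i).grad x))) x := fun i =>
    (S i).ae_hasFDerivAt_u h𝒞 hΩ hL
  have huincr : ∀ i, ∫⁻ x, ‖(S (i + 1)).u x - (S i).u x‖ₑ ≤
      ENNReal.ofReal R * (κ * volume Ω) * τ ^ i := by
    intro i
    have hG : ∀ᵐ x, HasFDerivAt (fun x => (S (i + 1)).u x - (S i).u x)
        (matCLM (vecMat ((S (i + 1)).grad x - (S i).grad x))) x := by
      filter_upwards [hfd (i + 1), hfd i] with x h1 h2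
      rw [vecMat_sub, matCLM_sub]
      exact h1.sub h2
    refine (lintegral_enorm_le_of_lipschitz hn ((hlip (i + 1)).sub (hlip i)) hG (hoff i)).trans ?_
    simp only [matVec_vecMat]
    rw [mul_assoc]
    gcongr
    exact hincr i
  obtain ⟨u, hu_m, hu⟩ := measurable_limit_of_tendsto_metrizable_ae (fun i => (hum i).aemeasurable)
    (ae_exists_tendsto_of_tsum_lintegral_ne_top (μ := volume) hum
      (ne_top_of_le_ne_top (hgeom _ (ENNReal.mul_ne_top ENNReal.ofReal_ne_top hκv))
        (ENNReal.tsum_le_tsum huincr)))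
  -- bounds
  have : Nonempty (Fin n) := ⟨⟨0, hn⟩⟩
  -- At `y` every stage equals the original affine map; with the common Lipschitz constant this
  -- gives a growth bound independent of the stage.
  obtain ⟨y, hy⟩ : ∃ y, y ∉ Ω := by
    by_contra h
    push Not at h
    rw [← eq_univ_iff_forall] at h
    rw [h] at hΩb
    exact NormedSpace.unbounded_univ ℝ (Vec n) hΩb
  set β : Vec n → ℝ := fun x => L * ‖x - y‖ + L * ‖y‖ with hβ
  have hub : ∀ i x, ‖(S i).u x‖ ≤ β x := by
    intro i x
    have h1 := (hlip i).dist_le_mul x y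
    rw [dist_eq_norm, dist_eq_norm, Real.coe_toNNReal _ hL0, (S i).off y hy] at h1
    have h2 : ‖matApply M₀ y‖ ≤ L * ‖y‖ := (norm_matApply_le _ _).trans (by gcongr)
    calc ‖(S i).u x‖ = ‖((S i).u x - matApply M₀ y) + matApply M₀ y‖ := by rw [sub_add_cancel]
      _ ≤ _ := (norm_add_le _ _).trans (add_le_add h1 h2)
  have hgb : ∀ i, ∀ᵐ x, ‖(S i).grad x‖ ≤ L := fun i => (S i).ae_norm_grad_le hL
  have hFb : ∀ᵐ x, ‖F x‖ ≤ L := by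
    filter_upwards [hF, eventually_countable_forall.2 hgb] with x h1 h2
    exact le_of_tendsto' h1.norm h2
  have hweak : ∀ i, HasWeakGradient (S i).u fun x => vecMat ((S i).grad x) := by
    intro i
    refine hasWeakGradient_of_lipschitz (hlip i) (hfd i) fun a b => ?_
    have := hgm i
    refine (continuous_const (y := L)).locallyIntegrable.mono
      (Measurable.aestronglyMeasurable (by simp only [vecMat_apply]; fun_prop)) ?_
    filter_upwards [hgb i] with x hx
    exact (PiLp.norm_apply_le _ _).trans (hx.trans (le_abs_self _))
  refine ⟨u, F, hFm, ⟨hasWeakGradient_of_tendsto hweak hu_m hFm hum hgm hu hF (β := β)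
    (by fun_prop) (fun i => Eventually.of_forall (hub i)) hgb, fun R => ?_⟩, ?_, ?_, hFb, ?_⟩
  · refine ⟨max (L * (R + ‖y‖) + L * ‖y‖) L, ?_⟩
    filter_upwards [ae_restrict_of_ae hu, ae_restrict_of_ae hFb,
      ae_restrict_mem measurableSet_ball] with x h1 h2 h3
    refine ⟨le_max_of_le_left ?_, le_max_of_le_right ?_⟩
    · refine (le_of_tendsto' h1.norm fun i => hub i x).trans ?_
      rw [mem_ball_zero_iff] at h3
      simp only [hβ]
      gcongr
      exact (norm_sub_le _ _).trans (by gcongr)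
    · rwa [matNorm_eq, matVec_vecMat]
  · have hmm : ∀ i, Measurable fun x => ∑ e, ((S i).piece e).indicator
        (fun _ => μ ^ (S i).level e) x := fun i => Finset.measurable_fun_sum _ fun e _ =>
      measurable_const.indicator ((S i).measurableSet_piece h𝒞 e)
    -- The masses are summable, so at almost every point of `Ω` the sequence `μ^level` is summable
    -- and the levels are unbounded.
    have hsum : ∫⁻ x, ∑' i, ∑ e, ((S i).piece e).indicator (fun _ => μ ^ (S i).level e) x ≠ ⊤ := by
      rw [lintegral_tsum fun i => (hmm i).aemeasurable]
      refine ne_top_of_le_ne_top (hgeom _ hvol) (ENNReal.tsum_le_tsum fun i => ?_)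
      refine le_trans (le_of_eq ?_) (hmass i)
      rw [lintegral_finsetSum _ fun e _ =>
        measurable_const.indicator ((S i).measurableSet_piece h𝒞 e)]
      exact Finset.sum_congr rfl fun e _ =>
        lintegral_indicator_const ((S i).measurableSet_piece h𝒞 e) _
    filter_upwards [hF, ae_lt_top (Measurable.tsum hmm) hsum,
      eventually_countable_forall.2 fun i => (S i).ae_mem] with x h1 h2 h3 hxΩ
    choose e he using fun i => h3 i hxΩ
    have hlev : ∀ i, (S (i + 1)).level (e (i + 1)) = (S i).level (e i) + 1 ∨
        (S (i + 1)).level (e (i + 1)) = (S i).level (e i) := by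
      intro i
      obtain ⟨j, hj, hj'⟩ := (hS i).parent (e (i + 1))
      rwa [(S i).eq_of_mem (hj (he (i + 1))) (he i)] at hj'
    have hzero := ENNReal.tendsto_atTop_zero_of_tsum_ne_top h2.ne
    have hzero' : Tendsto (fun i => μ ^ (S i).level (e i)) atTop (𝓝 0) :=
      hzero.congr fun i => (S i).sum_indicator (fun e _ => μ ^ (S i).level e) (he i)
    obtain ⟨idx, hidx, hidx'⟩ := exists_index_of_level
      (lev := fun i => (S i).level (e i)) hlev fun l => by
        obtain ⟨i, hi⟩ := (hzero'.eventually (gt_mem_nhds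
          (pos_iff_ne_zero.2 (pow_ne_zero l hμ)))).exists
        refine ⟨i, ?_⟩
        by_contra! hlt
        exact absurd hi (not_lt.2 (pow_le_pow_right_of_le_one' hμ1.le hlt.le))
    -- Along the stages at which the point has level `l`, the gradient lies in `W l` and still
    -- converges to the limit.
    refine hK (fun l => vecMat ((S (idx l)).grad x)) _ ?_
      ((continuous_vecMat.tendsto _).comp (h1.comp hidx'))
    filter_upwards [eventually_ge_atTop ((S 0).level (e 0))] with l hl
    have := (S (idx l)).mat_mem (e (idx l))
    rw [hidx l hl] at this
    rwa [(S (idx l)).grad_of_mem (he (idx l))]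
  · filter_upwards [hF] with x hx hxΩ
    have : Tendsto (fun i => (S i).grad x) atTop (𝓝 (matVec M₀)) :=
      tendsto_const_nhds.congr fun i => ((S i).grad_of_notMem hxΩ).symm
    rw [tendsto_nhds_unique hx this, vecMat_matVec]
  · refine lintegral_translate_sub_le_of_tendsto hgm ⟨matVec M₀, fun x => ?_⟩ hF hθ hθ1 hincr ?_
    · simp [S, Stage.grad, Stage.initial]
    · intro i h
      refine ((S i).lintegral_translate_sub_grad_le h𝒞 hL h).trans ?_
      rw [mul_assoc (ENNReal.ofReal (2 * L)) _ (Λ ^ i)]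
      gcongr
      exact hper i

/-! ### Steps from a system of replacements -/

lemma chain_of_lt {n m : ℕ} {Ut U : ℕ → ℕ → Set (Mat n)} {k l : ℕ} (hl : l < m) :
    chain m Ut U k l = Ut k l := if_pos hl

lemma chain_of_le {n m : ℕ} {Ut U : ℕ → ℕ → Set (Mat n)} {k l : ℕ} (hl : m ≤ l) :
    chain m Ut U k l = U (k + l / m) (l % m) := if_neg hl.not_gt

lemma chain_self {n m : ℕ} (hm : 1 ≤ m) {Ut U : ℕ → ℕ → Set (Mat n)}
    (h : ∀ k, Ut k m = U k m ∧ U k m = U (k + 1) 0) (k : ℕ) : chain m Ut U k m = Ut k m := by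
  rw [chain_of_le le_rfl, Nat.div_self hm, Nat.mod_self, (h k).1, (h k).2]

lemma chain_succ_of_lt {n m : ℕ} (hm : 1 ≤ m) {Ut U : ℕ → ℕ → Set (Mat n)}
    (h : ∀ k, Ut k m = U k m ∧ U k m = U (k + 1) 0) {k l : ℕ} (hl : l < m) :
    chain m Ut U k (l + 1) = Ut k (l + 1) := by
  rcases (Nat.succ_le_of_lt hl).lt_or_eq with h1 | h1
  · exact chain_of_lt h1
  · rw [show l + 1 = m from h1, chain_self hm h]

/-- Inside a block this is immediate; at its end the set `U_k^m` is identified with the first set of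
the next block. -/
lemma chain_succ_of_le {n m : ℕ} (hm : 1 ≤ m) {Ut U : ℕ → ℕ → Set (Mat n)}
    (h : ∀ k, Ut k m = U k m ∧ U k m = U (k + 1) 0) {k l : ℕ} (hl : m ≤ l) :
    chain m Ut U k (l + 1) = U (k + l / m) (l % m + 1) := by
  rw [chain_of_le (show m ≤ l + 1 by omega)]
  have h1 : l % m < m := Nat.mod_lt l hm
  have h2 := Nat.div_add_mod l m
  rcases (Nat.succ_le_of_lt h1).lt_or_eq with h3 | h3
  · have h4 : l + 1 = (l % m + 1) + m * (l / m) := by omega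
    rw [h4, Nat.add_mul_div_left _ _ hm, Nat.add_mul_mod_self_left, Nat.div_eq_of_lt h3,
      Nat.mod_eq_of_lt h3, Nat.zero_add]
  · have h4 : l + 1 = m * (l / m + 1) := by rw [Nat.mul_succ]; omega
    have h5 : l % m + 1 = m := h3
    rw [h5, (h _).2, h4, Nat.mul_div_cancel_left _ hm, Nat.mul_mod_right, add_assoc]

/-! ### Bookkeeping of the nonuniform perimeter constant -/

/-- The weight of a piece: a power of the nonuniform constant, whose exponent is the number of
times that this constant can still occur. -/
def phaseWeight {n : ℕ} (m : ℕ) (𝒞₁ : ℕ → Mat n → Set (Set (Vec n))) (c : ℝ≥0∞) (l : ℕ)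
    (M : Mat n) (D : Set (Vec n)) : ℝ≥0∞ :=
  open scoped Classical in
  -- Two powers per remaining first-phase level: one for entering the special class, already spent
  -- by its members, and one for moving up a level.
  if l < m then c ^ (2 * (m - l) - if D ∈ 𝒞₁ l M then 1 else 0) else 1

section phaseWeight

variable {n m : ℕ} {𝒞₁ : ℕ → Mat n → Set (Set (Vec n))} {c : ℝ≥0∞} {l : ℕ} {M : Mat n}
  {D : Set (Vec n)}

lemma one_le_phaseWeight (hc : 1 ≤ c) : 1 ≤ phaseWeight m 𝒞₁ c l M D := by
  rw [phaseWeight]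
  split_ifs
  · exact one_le_pow_of_one_le' hc _
  · exact one_le_pow_of_one_le' hc _
  · exact le_rfl

lemma phaseWeight_le (hc : 1 ≤ c) : phaseWeight m 𝒞₁ c l M D ≤ c ^ (2 * (m - l)) := by
  rw [phaseWeight]
  split_ifs
  · exact pow_le_pow_right₀ hc (by omega)
  · exact pow_le_pow_right₀ hc (by omega)
  · exact one_le_pow_of_one_le' hc _

lemma phaseWeight_of_mem (hl : l < m) (hD : D ∈ 𝒞₁ l M) :
    phaseWeight m 𝒞₁ c l M D = c ^ (2 * (m - l) - 1) := by
  rw [phaseWeight, if_pos hl, if_pos hD]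

lemma phaseWeight_of_notMem (hl : l < m) (hD : D ∉ 𝒞₁ l M) :
    phaseWeight m 𝒞₁ c l M D = c ^ (2 * (m - l)) := by
  rw [phaseWeight, if_pos hl, if_neg hD, Nat.sub_zero]

lemma phaseWeight_of_le (hl : m ≤ l) : phaseWeight m 𝒞₁ c l M D = 1 := by
  rw [phaseWeight, if_neg hl.not_gt]

/-- Even a special piece has one power of `c` more than the bound `2(m - (l + 1))` on the exponent
at the next level; it pays for the passage to good pieces. -/
lemma le_phaseWeight (hl : l < m) (hc : 1 ≤ c) :
    c ^ (2 * (m - l) - 1) ≤ phaseWeight m 𝒞₁ c l M D := by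
  by_cases hD : D ∈ 𝒞₁ l M
  · rw [phaseWeight_of_mem hl hD]
  · rw [phaseWeight_of_notMem hl hD]
    exact pow_le_pow_right₀ hc (by omega)

end phaseWeight

/-! ### Volume, gradient and weighted perimeter estimates for one replacement -/

namespace Replacement

variable {n : ℕ} {𝒞 : Set (Set (Vec n))} {V : Set (Mat n)} {v₁ C₃ : ℝ} {M : Mat n}
  {D : Set (Vec n)}

lemma good_volume_le (h𝒞 : IsDomainClass 𝒞) (r : Replacement 𝒞 V v₁ C₃ M D) :
    ∑ i ∈ r.good, volume (r.piece i) ≤ volume D := by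
  rw [← r.sum_volume h𝒞]
  exact Finset.sum_le_sum_of_subset (Finset.subset_univ _)

/-- With `g` and `b` the good and bad volumes, `μ g + b = |D| - (1 - μ) g`, and `g ≥ v₁ |D|`. -/
lemma weighted_volume_le (h𝒞 : IsDomainClass 𝒞) (hD : D ∈ 𝒞) (r : Replacement 𝒞 V v₁ C₃ M D)
    (hv₁ : 0 ≤ v₁) {μ : ℝ} (hμ0 : 0 ≤ μ) (hμ1 : μ ≤ 1) :
    ENNReal.ofReal μ * (∑ i ∈ r.good, volume (r.piece i)) + ∑ i ∈ r.goodᶜ, volume (r.piece i) ≤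
      ENNReal.ofReal (1 - (1 - μ) * v₁) * volume D := by
  have hV : volume D ≠ ⊤ := (h𝒞 D hD).2.1.measure_lt_top.ne
  have h1 := r.good_volume
  have h2 := r.sum_volume h𝒞
  rw [← Finset.sum_add_sum_compl r.good] at h2
  generalize (∑ i ∈ r.good, volume (r.piece i)) = g at *
  generalize (∑ i ∈ r.goodᶜ, volume (r.piece i)) = b at *
  have hg : g ≠ ⊤ := ne_top_of_le_ne_top hV (h2 ▸ le_self_add)
  have hb : b ≠ ⊤ := ne_top_of_le_ne_top hV (h2 ▸ le_add_self)
  rw [← h2] at h1 ⊢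
  lift g to NNReal using hg
  lift b to NNReal using hb
  rw [← ENNReal.ofReal_coe_nnreal, ← ENNReal.ofReal_coe_nnreal (p := b),
    ← ENNReal.ofReal_add (by positivity) (by positivity), ← ENNReal.ofReal_mul hv₁,
    ENNReal.ofReal_le_ofReal_iff (by positivity)] at h1
  rw [← ENNReal.ofReal_coe_nnreal, ← ENNReal.ofReal_coe_nnreal (p := b),
    ← ENNReal.ofReal_add (by positivity) (by positivity), ← ENNReal.ofReal_mul hμ0,
    ← ENNReal.ofReal_add (by positivity) (by positivity), ← ENNReal.ofReal_mul' (by positivity)]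
  refine ENNReal.ofReal_le_ofReal ?_
  nlinarith

lemma enorm_grad_sub_le (h𝒞 : IsDomainClass 𝒞) (hD : D ∈ 𝒞) (hne : D.Nonempty)
    (r : Replacement 𝒞 V v₁ C₃ M D) (i : Fin r.N) :
    ‖matVec (r.grad i) - matVec M‖ₑ ≤ ENNReal.ofReal (2 * C₃) := by
  rw [← ofReal_norm]
  refine ENNReal.ofReal_le_ofReal ((norm_sub_le _ _).trans ?_)
  rw [← matNorm_eq, ← matNorm_eq]
  linarith [r.grad_bound i, r.matNorm_le h𝒞 hD hne]

lemma sum_enorm_grad_sub_le (h𝒞 : IsDomainClass 𝒞) (hD : D ∈ 𝒞)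
    (r : Replacement 𝒞 V v₁ C₃ M D) :
    ∑ i ∈ r.good, ‖matVec (r.grad i) - matVec M‖ₑ * volume (r.piece i) ≤
      ENNReal.ofReal (2 * C₃) * volume D := by
  rcases D.eq_empty_or_nonempty with rfl | hne
  · refine (Finset.sum_eq_zero fun i _ => ?_).le.trans zero_le
    rw [subset_empty_iff.1 (r.piece_subset i), measure_empty, mul_zero]
  · refine (Finset.sum_le_sum fun i _ => mul_le_mul_left (r.enorm_grad_sub_le h𝒞 hD hne i) _).trans ?_
    rw [← Finset.mul_sum]
    gcongr
    exact r.good_volume_le h𝒞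

/-- On the set of closeness the increment is at most `ε`; off it the crude bound `2 C₃` acts on a
fraction at most `ε` of the good volume. -/
lemma sum_enorm_grad_sub_le_of_secondPhaseBounds (h𝒞 : IsDomainClass 𝒞) (hD : D ∈ 𝒞)
    (r : Replacement 𝒞 V v₁ C₃ M D) {C₁ ε : ℝ} (hC₃ : 0 ≤ C₃) (hε : 0 ≤ ε)
    (h : SecondPhaseBounds r C₁ ε) :
    ∑ i ∈ r.good, ‖matVec (r.grad i) - matVec M‖ₑ * volume (r.piece i) ≤
      ENNReal.ofReal ((1 + 2 * C₃) * ε) * volume D := by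
  rcases D.eq_empty_or_nonempty with rfl | hne
  · refine (Finset.sum_eq_zero fun i _ => ?_).le.trans zero_le
    rw [subset_empty_iff.1 (r.piece_subset i), measure_empty, mul_zero]
  obtain ⟨-, S, hSm, hS, hvol, hclose⟩ := h
  set G := ∑ i ∈ r.good, volume (r.piece i) with hG
  have hGle : G ≤ volume D := r.good_volume_le h𝒞
  have hGtop : G ≠ ⊤ := ne_top_of_le_ne_top (h𝒞 D hD).2.1.measure_lt_top.ne hGle
  have hSle : volume S ≤ ∑ i ∈ r.good, volume (r.piece i ∩ S) := by
    refine (measure_mono fun x hx => ?_).trans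
      (measure_biUnion_finset_le r.good fun i => r.piece i ∩ S)
    obtain ⟨i, hi, hxi⟩ := mem_iUnion₂.1 (hS hx)
    exact mem_iUnion₂.2 ⟨i, hi, hxi, hx⟩
  have hsplit : ∑ i ∈ r.good, volume (r.piece i ∩ S) + ∑ i ∈ r.good, volume (r.piece i \ S) = G := by
    rw [← Finset.sum_add_distrib]
    exact Finset.sum_congr rfl fun i _ => measure_inter_add_sdiff _ hSm
  have hrest : ∑ i ∈ r.good, volume (r.piece i \ S) ≤ ENNReal.ofReal ε * G := by
    -- For `ε ≥ 1` the factor `ENNReal.ofReal (1 - ε)` is `0` and the hypothesis carries no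
    -- information, but the claim is trivial.
    rcases le_or_gt 1 ε with h1 | h1
    · calc _ ≤ G := hsplit ▸ le_add_self
        _ ≤ ENNReal.ofReal ε * G := le_mul_of_one_le_left zero_le (by simpa using h1)
    · have h2 : ENNReal.ofReal (1 - ε) * G + ENNReal.ofReal ε * G = G := by
        rw [← add_mul, ← ENNReal.ofReal_add (by linarith) hε, sub_add_cancel, ENNReal.ofReal_one,
          one_mul]
      refine (ENNReal.add_le_add_iff_left
        (ENNReal.mul_ne_top (ENNReal.ofReal_ne_top (r := 1 - ε)) hGtop)).1 ?_
      rw [h2]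
      calc _ ≤ ∑ i ∈ r.good, volume (r.piece i ∩ S) + ∑ i ∈ r.good, volume (r.piece i \ S) := by
            gcongr
            exact hvol.trans hSle
        _ = G := hsplit
  have hterm : ∀ i ∈ r.good, ‖matVec (r.grad i) - matVec M‖ₑ * volume (r.piece i) ≤
      ENNReal.ofReal ε * volume (r.piece i) + ENNReal.ofReal (2 * C₃) * volume (r.piece i \ S) := by
    intro i hi
    conv_lhs => rw [← measure_inter_add_sdiff (r.piece i) hSm, mul_add]
    refine add_le_add ?_ (mul_le_mul_left (r.enorm_grad_sub_le h𝒞 hD hne i) _)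
    rcases (r.piece i ∩ S).eq_empty_or_nonempty with h0 | ⟨x, hx, hxS⟩
    · simp [h0]
    · refine mul_le_mul' ?_ (measure_mono inter_subset_left)
      rw [← ofReal_norm, ← matVec_sub, ← matNorm_eq]
      exact ENNReal.ofReal_le_ofReal (hclose i hi x ⟨hxS, hx⟩)
  calc _ ≤ ∑ i ∈ r.good, (ENNReal.ofReal ε * volume (r.piece i) +
        ENNReal.ofReal (2 * C₃) * volume (r.piece i \ S)) := Finset.sum_le_sum hterm
    _ ≤ ENNReal.ofReal ε * G + ENNReal.ofReal (2 * C₃) * (ENNReal.ofReal ε * G) := by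
        rw [Finset.sum_add_distrib, ← Finset.mul_sum, ← Finset.mul_sum]
        gcongr
    _ = ENNReal.ofReal ((1 + 2 * C₃) * ε) * G := by
        rw [← mul_assoc, ← add_mul, ← ENNReal.ofReal_mul (by positivity),
          ← ENNReal.ofReal_add hε (by positivity)]
        congr 2; ring
    _ ≤ _ := by gcongr

/-- A nonuniform constant occurs only where the exponent of the weight drops: on good pieces, whose
level rises, and on bad pieces that newly enter the special class. Each of these families costs one
copy of the old weighted perimeter, giving the `2`. The other bad pieces cost only the uniform `C₂`.
-/
lemma sum_phaseWeight_le (r : Replacement 𝒞 V v₁ C₃ M D) {m l : ℕ} (hl : l < m)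
    {𝒞₁ : ℕ → Mat n → Set (Set (Vec n))} {c₀ c C₂ : ℝ} (hc : 1 ≤ c) (hc₀ : c₀ ≤ c)
    (h : FirstPhaseBounds r (𝒞₁ l M) c₀ C₂) :
    (∑ i ∈ r.good, phaseWeight m 𝒞₁ (ENNReal.ofReal c) (l + 1) (r.grad i) (r.piece i) *
        perimeter (r.piece i)) +
      ∑ i ∈ r.goodᶜ, phaseWeight m 𝒞₁ (ENNReal.ofReal c) l M (r.piece i) *
        perimeter (r.piece i) ≤
      (ENNReal.ofReal C₂ + 2) * (phaseWeight m 𝒞₁ (ENNReal.ofReal c) l M D * perimeter D) := by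
  obtain ⟨h1, h2, h3⟩ := h
  have hcc : ENNReal.ofReal c₀ ≤ ENNReal.ofReal c := ENNReal.ofReal_le_ofReal hc₀
  have hc1 : 1 ≤ ENNReal.ofReal c := by simpa using hc
  generalize ENNReal.ofReal c = b at *
  have hgood : ∑ i ∈ r.good, phaseWeight m 𝒞₁ b (l + 1) (r.grad i) (r.piece i) *
      perimeter (r.piece i) ≤ phaseWeight m 𝒞₁ b l M D * perimeter D := by
    calc _ ≤ ∑ i ∈ r.good, b ^ (2 * (m - (l + 1))) * perimeter (r.piece i) := by
          gcongr
          exact phaseWeight_le hc1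
      _ ≤ b ^ (2 * (m - (l + 1))) * (b * perimeter D) := by
          rw [← Finset.mul_sum]
          gcongr
          exact h1.trans (by gcongr)
      _ = b ^ (2 * (m - l) - 1) * perimeter D := by
          rw [← mul_assoc, ← pow_succ]
          congr 2; omega
      _ ≤ _ := by
          gcongr
          exact le_phaseWeight hl hc1
  by_cases hD : D ∈ 𝒞₁ l M
  · obtain ⟨h4, h5⟩ := h2 hD
    have hbad : ∑ i ∈ r.goodᶜ, phaseWeight m 𝒞₁ b l M (r.piece i) * perimeter (r.piece i) ≤
        ENNReal.ofReal C₂ * (phaseWeight m 𝒞₁ b l M D * perimeter D) := by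
      calc _ = ∑ i ∈ r.goodᶜ, phaseWeight m 𝒞₁ b l M D * perimeter (r.piece i) := by
            refine Finset.sum_congr rfl fun i hi => ?_
            rw [phaseWeight_of_mem hl hD, phaseWeight_of_mem hl (h4 i (Finset.mem_compl.1 hi))]
        _ ≤ phaseWeight m 𝒞₁ b l M D * (ENNReal.ofReal C₂ * perimeter D) := by
            rw [← Finset.mul_sum]
            gcongr
        _ = _ := by ring
    refine (add_le_add hgood hbad).trans ?_
    rw [add_mul, add_comm]
    exact add_le_add le_rfl (le_mul_of_one_le_left zero_le one_le_two)
  · obtain ⟨S₁, S₂, hdisj, hun, h4, h5, h6⟩ := h3 hD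
    have hS₁ : ∑ i ∈ S₁, phaseWeight m 𝒞₁ b l M (r.piece i) * perimeter (r.piece i) ≤
        phaseWeight m 𝒞₁ b l M D * perimeter D := by
      calc _ = ∑ i ∈ S₁, b ^ (2 * (m - l) - 1) * perimeter (r.piece i) :=
            Finset.sum_congr rfl fun i hi => by rw [phaseWeight_of_mem hl (h4 i hi)]
        _ ≤ b ^ (2 * (m - l) - 1) * (b * perimeter D) := by
            rw [← Finset.mul_sum]
            gcongr
            exact h5.trans (by gcongr)
        _ = _ := by
            rw [phaseWeight_of_notMem hl hD, ← mul_assoc, ← pow_succ]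
            congr 2; omega
    have hS₂ : ∑ i ∈ S₂, phaseWeight m 𝒞₁ b l M (r.piece i) * perimeter (r.piece i) ≤
        ENNReal.ofReal C₂ * (phaseWeight m 𝒞₁ b l M D * perimeter D) := by
      calc _ ≤ ∑ i ∈ S₂, b ^ (2 * (m - l)) * perimeter (r.piece i) := by
            gcongr
            exact phaseWeight_le hc1
        _ ≤ b ^ (2 * (m - l)) * (ENNReal.ofReal C₂ * perimeter D) := by
            rw [← Finset.mul_sum]
            gcongr
        _ = _ := by
            rw [phaseWeight_of_notMem hl hD]
            ring
    rw [← hun, Finset.sum_union hdisj]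
    refine (add_le_add hgood (add_le_add hS₁ hS₂)).trans (le_of_eq ?_)
    ring

end Replacement

/-- Levels below `m` use the first phase at `k₀`; a level `l ≥ m` uses the second phase at `k₀ + l /
m`. The growth factor does not involve `c`, which is confined to the weight. -/
lemma hasSteps_of_replacementSystem {n m : ℕ} (hm : 1 ≤ m) {𝒞 : Set (Set (Vec n))}
    (h𝒞 : IsDomainClass 𝒞) {𝒞₁ : ℕ → ℕ → Mat n → Set (Set (Vec n))} {Vt V : ℕ → ℕ → Set (Mat n)}
    {C₀ : ℕ → ℕ → ℝ} {C₁ C₂ C₃ v₁ c₂ μ : ℝ} (hC₁ : 1 ≤ C₁) (hC₂ : 1 ≤ C₂) (hC₃ : 1 < C₃)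
    (hv₁ : 0 < v₁ ∧ v₁ < 1) (hc₂ : 0 < c₂ ∧ c₂ < 1) (hμ0 : 0 < μ) (hμ1 : μ < 1) (hμ : μ ^ m = c₂)
    (hV : ∀ k, Vt k m = V k m ∧ V k m = V (k + 1) 0)
    (hsys : ReplacementSystem m 𝒞 𝒞₁ Vt V C₀ C₁ C₂ C₃ v₁ c₂) {k₀ : ℕ} {c : ℝ} (hc : 1 ≤ c)
    (hC₀ : ∀ j, j < m → C₀ j k₀ ≤ c) :
    HasSteps 𝒞 (chain m Vt V k₀) v₁ C₃ (phaseWeight m (𝒞₁ k₀) (ENNReal.ofReal c))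
      (ENNReal.ofReal (C₁ + C₂ + 2)) (ENNReal.ofReal ((1 + 2 * C₃) * (C₃ / c₂)))
      (ENNReal.ofReal μ) (ENNReal.ofReal (1 - (1 - μ) * v₁)) := by
  intro l M hM D hD
  rcases lt_or_ge l m with hl | hl
  · rw [chain_of_lt hl] at hM
    rw [chain_succ_of_lt hm hV hl]
    obtain ⟨r, hr⟩ := hsys.first k₀ l hl M hM D hD
    refine ⟨r, ?_, ?_, r.weighted_volume_le h𝒞 hD hv₁.1.le hμ0.le hμ1.le⟩
    · refine (r.sum_phaseWeight_le hl hc (hC₀ l hl) hr).trans ?_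
      gcongr
      rw [show (2 : ℝ≥0∞) = ENNReal.ofReal 2 by simp, ← ENNReal.ofReal_add (by linarith) (by simp)]
      exact ENNReal.ofReal_le_ofReal (by linarith)
    · refine (r.sum_enorm_grad_sub_le h𝒞 hD).trans ?_
      rw [← mul_assoc, ← ENNReal.ofReal_pow hμ0.le, ← ENNReal.ofReal_mul (by
        have := hc₂.1; positivity)]
      refine mul_le_mul_left (ENNReal.ofReal_le_ofReal ?_) _
      -- No closeness is available in the first phase, but there `μ^l ≥ μ^m = c₂`; hence the
      -- division by `c₂` in `κ`.
      have h1 : c₂ ≤ μ ^ l := hμ ▸ pow_le_pow_of_le_one hμ0.le hμ1.le hl.le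
      have h2 : C₃ ≤ C₃ / c₂ * μ ^ l := by
        rw [div_mul_eq_mul_div, le_div_iff₀ hc₂.1]
        gcongr
      calc 2 * C₃ ≤ (1 + 2 * C₃) * C₃ := by nlinarith
        _ ≤ (1 + 2 * C₃) * (C₃ / c₂ * μ ^ l) := by gcongr
        _ = _ := by ring
  · rw [chain_of_le hl] at hM
    rw [chain_succ_of_le hm hV hl]
    obtain ⟨r, hr⟩ := hsys.second (k₀ + l / m) (l % m) (Nat.mod_lt l hm) M hM D hD
    refine ⟨r, ?_, ?_, r.weighted_volume_le h𝒞 hD hv₁.1.le hμ0.le hμ1.le⟩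
    · simp only [phaseWeight_of_le hl, phaseWeight_of_le (hl.trans (Nat.le_succ l)), one_mul]
      rw [Finset.sum_add_sum_compl]
      refine hr.1.trans ?_
      gcongr
      linarith
    · have hε : 0 ≤ C₃ * c₂ ^ (k₀ + l / m) := by have := hc₂.1; positivity
      refine (r.sum_enorm_grad_sub_le_of_secondPhaseBounds h𝒞 hD (by linarith) hε hr).trans ?_
      rw [← mul_assoc (ENNReal.ofReal _), ← ENNReal.ofReal_pow hμ0.le, ← ENNReal.ofReal_mul (by
        have := hc₂.1; positivity), mul_assoc (1 + 2 * C₃)]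
      refine mul_le_mul_left (ENNReal.ofReal_le_ofReal ?_) _
      refine mul_le_mul_of_nonneg_left ?_ (by linarith)
      rw [div_mul_eq_mul_div, le_div_iff₀ hc₂.1, mul_assoc, ← pow_succ]
      gcongr
      -- Rounding `l / m` down loses less than one block of `m` levels, which the extra factor `c₂`
      -- compensates.
      calc c₂ ^ (k₀ + l / m + 1) ≤ c₂ ^ (l / m + 1) :=
            pow_le_pow_of_le_one hc₂.1.le hc₂.2.le (by omega)
        _ = μ ^ (m * (l / m + 1)) := by rw [pow_mul, hμ]
        _ ≤ μ ^ l := by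
            refine pow_le_pow_of_le_one hμ0.le hμ1.le ?_
            have h1 := Nat.div_add_mod l m
            have h2 := Nat.mod_lt l hm
            rw [Nat.mul_succ]
            omega

/-! ### The exponent and the constant -/

/-- For `θ = 1/(N+1)` the product is `(τ^N Λ)^(1/(N+1))`, and `τ^N Λ < 1` for large `N`. -/
lemma exists_exponent {τ Λ : ℝ≥0∞} (hτ : τ < 1) (hΛ : Λ ≠ ⊤) :
    ∃ θ : ℝ, 0 < θ ∧ θ < 1 ∧ τ ^ (1 - θ) * Λ ^ θ < 1 := by
  have h1 : Tendsto (fun N : ℕ => τ ^ N * Λ) atTop (𝓝 0) := by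
    simpa using ENNReal.Tendsto.mul_const (ENNReal.tendsto_pow_atTop_nhds_zero_of_lt_one hτ)
      (Or.inr hΛ)
  obtain ⟨N, hN, hN1⟩ := ((h1.eventually (gt_mem_nhds zero_lt_one)).and
    (eventually_ge_atTop 1)).exists
  have hN0 : (0 : ℝ) < N := by exact_mod_cast hN1
  have hθ : (0 : ℝ) < 1 / (N + 1) := by positivity
  refine ⟨1 / (N + 1), hθ, ?_, ?_⟩
  · rw [div_lt_one (by positivity)]
    linarith
  · have h2 : (1 : ℝ) - 1 / (N + 1) = N * (1 / (N + 1)) := by field_simp; ring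
    rw [h2, ENNReal.rpow_mul, ENNReal.rpow_natCast, ← ENNReal.mul_rpow_of_nonneg _ _ hθ.le]
    exact ENNReal.rpow_lt_one hN hθ

lemma nikolskiiConst_mono {a b b' τ Λ : ℝ≥0∞} {θ : ℝ} (hθ : 0 ≤ θ) (h : b ≤ b') :
    nikolskiiConst a b τ Λ θ ≤ nikolskiiConst a b' τ Λ θ := by
  unfold nikolskiiConst
  gcongr

lemma wspNorm_empty {n : ℕ} {s p : ℝ} (hp : 0 < p) (F : Vec n → Mat n) : wspNorm s p ∅ F = 0 := by
  simp [wspNorm, hp]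

end

/-! ### The main theorem: exponent, constant and starting level -/

/-- Higher Sobolev regularity of convex integration solutions. -/
theorem theorem2 (n m : ℕ) (hn : 1 ≤ n) (hm : 1 ≤ m)
    (C₁ C₂ v₁ c₂ : ℝ) (hC₁ : 1 ≤ C₁) (hC₂ : 1 ≤ C₂)
    (hv₁ : 0 < v₁ ∧ v₁ < 1) (hc₂ : 0 < c₂ ∧ c₂ < 1) :
    ∃ θ₀ : ℝ, 0 < θ₀ ∧ θ₀ < 1 ∧
      ∀ s p : ℝ, 0 < s → s < 1 → 1 < p → s * p < θ₀ →
      ∀ Ω : Set (Vec n),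
      ∃ C : ℝ → ℝ → ℝ, (∀ a b, 1 < C a b) ∧
        ∀ (A K : Set (Mat n)) (G : Type*) [Group G] [MulAction G (lamHull K)]
          (N : ℕ) (well : Fin N → lamHull K) (Ut U : ℕ → ℕ → Set (Mat n))
          (𝒞 : Set (Set (Vec n))) (𝒞₁ : ℕ → ℕ → Mat n → Set (Set (Vec n)))
          (C₀ : ℕ → ℕ → ℝ) (C₃ : Mat n → ℝ),
          (∀ j k, 1 ≤ C₀ j k) → (∀ M, 1 < C₃ M) →
          IsDomainClass 𝒞 → (∀ k j M, 𝒞₁ k j M ⊆ 𝒞) →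
          WellStructure A K G N well →
          InvariantInApproximation m A K G Ut U →
          HasReplacements m 𝒞 𝒞₁ Ut U C₀ C₁ C₂ C₃ v₁ c₂ →
          Ω ∈ 𝒞 →
          ∀ M₀ ∈ relInt A (lamHull K),
            ∃ (u : Vec n → Vec n) (Du : Vec n → Mat n),
              MemW1InftyLoc u Du ∧
              (∀ᵐ x, x ∈ Ω → Du x ∈ K) ∧
              (∀ᵐ x, x ∉ Ω → Du x = M₀) ∧
              (∀ D : Set (Vec n), IsOpen D → Bornology.IsBounded D → MemWsp s p D Du) ∧
              ∀ k j, j ≤ m → M₀ ∈ Ut k j → ∀ c₀ : ℝ, (∀ i, i < m → C₀ i k ≤ c₀) →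
                wspNorm s p Ω Du ≤ ENNReal.ofReal (C c₀ (C₃ M₀)) := by
  have hm0 : (m : ℝ) ≠ 0 := by positivity
  -- One level is weighted by the `m`-th root of `c₂`, so a full block of `m` levels gains exactly
  -- `c₂`.
  obtain ⟨μ, hμ0, hμ1, hμ⟩ : ∃ μ : ℝ, 0 < μ ∧ μ < 1 ∧ μ ^ m = c₂ := by
    refine ⟨c₂ ^ ((m : ℝ)⁻¹), Real.rpow_pos_of_pos hc₂.1 _,
      Real.rpow_lt_one hc₂.1.le hc₂.2 (by positivity), ?_⟩
    rw [← Real.rpow_natCast, ← Real.rpow_mul hc₂.1.le, inv_mul_cancel₀ hm0, Real.rpow_one]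
  set τ : ℝ≥0∞ := ENNReal.ofReal (1 - (1 - μ) * v₁) with hτdef
  set Λ : ℝ≥0∞ := ENNReal.ofReal (C₁ + C₂ + 2) with hΛdef
  have hτ : τ < 1 := by
    rw [hτdef, ENNReal.ofReal_lt_one]
    have : 0 < (1 - μ) * v₁ := mul_pos (by linarith) hv₁.1
    linarith
  have hΛ : Λ ≠ ⊤ := ENNReal.ofReal_ne_top
  obtain ⟨θ, hθ0, hθ1, hq⟩ := exists_exponent hτ hΛ
  refine ⟨θ, hθ0, hθ1, fun s p hs _ hp hsp Ω => ?_⟩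
  have hp0 : 0 < p := by linarith
  -- The constant is fixed before `Ω` is known to be bounded, so an arbitrary radius is used in the
  -- other case.
  obtain ⟨R, hR⟩ : ∃ R, Bornology.IsBounded Ω → Ω ⊆ Metric.ball 0 R := by
    by_cases h : Bornology.IsBounded Ω
    · obtain ⟨R, hR⟩ := h.subset_ball 0
      exact ⟨R, fun _ => hR⟩
    · exact ⟨0, fun h' => absurd h' h⟩
  set κ : ℝ → ℝ≥0∞ := fun b => ENNReal.ofReal ((1 + 2 * b) * (b / c₂)) with hκ
  set B : ℝ → ℝ → ℝ≥0∞ := fun a b => nikolskiiConst (κ b * volume Ω)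
    (ENNReal.ofReal (2 * b) * (ENNReal.ofReal a ^ (2 * m) * perimeter Ω)) τ Λ θ with hB
  set X : ℝ → ℝ → ℝ≥0∞ := fun a b => (ENNReal.ofReal (b ^ p) * volume Ω +
    ENNReal.ofReal ((2 * b) ^ (p - 1)) * (B a b * rieszIntegral n (θ - s * p) (2 * R))) ^ (1 / p)
    with hX
  -- The `2` makes the constant exceed `1`; the shift `a + 1` pays for a starting constant that is
  -- only within `1` of the infimum.
  refine ⟨fun a b => 2 + (X (a + 1) b).toReal, fun a b => ?_, ?_⟩
  · have : 0 ≤ (X (a + 1) b).toReal := ENNReal.toReal_nonneg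
    linarith
  intro A K G _ _ N well Ut U 𝒞 𝒞₁ C₀ C₃ hC₀ hC₃ h𝒞 _ _ hinv hrep hΩ M₀ hM₀
  obtain ⟨hΩo, hΩb, hΩp⟩ := h𝒞 Ω hΩ
  have hvol : volume Ω ≠ ⊤ := hΩb.measure_lt_top.ne
  have hriesz : ∀ r, rieszIntegral n (θ - s * p) r ≠ ⊤ := fun r =>
    (rieszIntegral_lt_top hn (by linarith) r).ne
  -- the level at which the construction starts, with an almost optimal constant
  set T : Set ℝ := {c | ∃ k j, j ≤ m ∧ M₀ ∈ Ut k j ∧ ∀ i, i < m → C₀ i k ≤ c} with hT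
  have hTbdd : ∀ c ∈ T, 1 ≤ c := by
    rintro c ⟨k, j, -, -, h⟩
    exact (hC₀ 0 k).trans (h 0 hm)
  have hTne : T.Nonempty := by
    rw [hinv.covers] at hM₀
    simp only [mem_iUnion] at hM₀
    obtain ⟨k, j, hj, hM⟩ := hM₀
    exact ⟨∑ i ∈ Finset.range m, C₀ i k, k, j, hj, hM, fun i hi =>
      Finset.single_le_sum (f := fun i => C₀ i k) (fun i _ => zero_le_one.trans (hC₀ i k))
        (Finset.mem_range.2 hi)⟩
  -- One map has to satisfy the bound for every admissible `k`, so `c` is chosen within `1` of the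
  -- infimum, which need not be attained.
  obtain ⟨c, hcT, hc⟩ := exists_lt_of_csInf_lt hTne (lt_add_one (sInf T))
  have hc_le : ∀ c' ∈ T, c ≤ c' + 1 := fun c' hc' =>
    hc.le.trans (by linarith [csInf_le ⟨1, hTbdd⟩ hc'])
  have hc1 : 1 ≤ c := hTbdd c hcT
  obtain ⟨k₀, j₀, hj₀, hM₀U, hcC₀⟩ := hcT
  obtain ⟨Vt, V, hsub, hmatch, hM₀V, hsys⟩ := hrep k₀ j₀ hj₀ M₀ hM₀U
  have hM₀W : M₀ ∈ chain m Vt V k₀ j₀ := by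
    rcases hj₀.lt_or_eq with h | rfl
    · rwa [chain_of_lt h]
    · rwa [chain_self hm hmatch]
  -- The construction runs in the subfamilies; inclusion lets them inherit the limit condition.
  have hW : ∀ i, chain m Vt V k₀ i ⊆ chain m Ut U k₀ i := by
    intro i
    rcases lt_or_ge i m with h | h
    · rw [chain_of_lt h, chain_of_lt h]
      exact (hsub k₀ i h.le).1
    · rw [chain_of_le h, chain_of_le h]
      exact (hsub _ _ (Nat.mod_lt i hm).le).2
  have hK : ∀ (Z : ℕ → Mat n) (Z' : Mat n), (∀ᶠ i in atTop, Z i ∈ chain m Vt V k₀ i) →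
      Tendsto Z atTop (𝓝 Z') → Z' ∈ K := fun Z Z' h1 h2 =>
    (hinv.inApprox k₀).limit Z Z' (h1.mono fun i hi => hW i hi) h2
  have hsteps := hasSteps_of_replacementSystem hm h𝒞 hC₁ hC₂ (hC₃ M₀) hv₁ hc₂ hμ0 hμ1 hμ hmatch
    hsys hc1 hcC₀
  have hcE : 1 ≤ ENNReal.ofReal c := by simpa using hc1
  obtain ⟨u, F, hFm, hu, hFK, hFM₀, hFL, hFt⟩ := exists_limit_of_hasSteps hn h𝒞 hΩ hK
    (le_max_left (C₃ M₀) (matNorm M₀)) (le_max_right _ _) hM₀W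
    (fun l M D => one_le_phaseWeight hcE) ENNReal.ofReal_ne_top
    (ENNReal.ofReal_pos.2 hμ0).ne' (ENNReal.ofReal_lt_one.2 hμ1) hτ hsteps hθ0 hθ1
  have hBtop : ∀ a b, B a b ≠ ⊤ := fun a b => (nikolskiiConst_lt_top hθ0 hθ1
    (ENNReal.mul_ne_top ENNReal.ofReal_ne_top hvol)
    (ENNReal.mul_ne_top ENNReal.ofReal_ne_top
      (ENNReal.mul_ne_top (ENNReal.pow_ne_top ENNReal.ofReal_ne_top) hΩp)) hΛ hq).ne
  have hweight : phaseWeight m (𝒞₁ k₀) (ENNReal.ofReal c) j₀ M₀ Ω ≤ ENNReal.ofReal c ^ (2 * m) :=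
    (phaseWeight_le hcE).trans (pow_le_pow_right₀ hcE (by omega))
  refine ⟨u, fun x => vecMat (F x), hu, hFK, hFM₀, ?_, ?_⟩
  · intro D hDo hDb
    obtain ⟨R', hR'⟩ := hDb.subset_ball 0
    refine ⟨fun i j => Measurable.aemeasurable (by simp only [vecMat_apply]; fun_prop), ?_⟩
    refine (wspNorm_le hs hp hsp hDo.measurableSet hR' hFm hFL hFt).trans_lt ?_
    refine ENNReal.rpow_lt_top_of_nonneg (by positivity) ?_
    refine ENNReal.add_ne_top.2 ⟨ENNReal.mul_ne_top ENNReal.ofReal_ne_top hDb.measure_lt_top.ne,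
      ENNReal.mul_ne_top ENNReal.ofReal_ne_top (ENNReal.mul_ne_top ?_ (hriesz _))⟩
    refine (nikolskiiConst_lt_top hθ0 hθ1 (ENNReal.mul_ne_top ENNReal.ofReal_ne_top hvol)
      (ENNReal.mul_ne_top ENNReal.ofReal_ne_top (ENNReal.mul_ne_top ?_ hΩp)) hΛ hq).ne
    exact ne_top_of_le_ne_top (ENNReal.pow_ne_top ENNReal.ofReal_ne_top) hweight
  · intro k j hj hMU c₀ hc₀
    -- A replacement on a nonempty `Ω` forces `|M₀| ≤ C₃ M₀`, so the maximum in the gradient bound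
    -- disappears from the constant. For empty `Ω` this argument fails, but the norm is `0`.
    rcases Ω.eq_empty_or_nonempty with rfl | hne
    · rw [wspNorm_empty hp0]
      exact zero_le
    obtain ⟨r, -⟩ := hsteps j₀ M₀ hM₀W Ω hΩ
    have hL : max (C₃ M₀) (matNorm M₀) = C₃ M₀ := max_eq_left (r.matNorm_le h𝒞 hΩ hne)
    rw [hL] at hFL hFt
    have hX_top : X (c₀ + 1) (C₃ M₀) ≠ ⊤ := by
      refine (ENNReal.rpow_lt_top_of_nonneg (by positivity) ?_).ne
      exact ENNReal.add_ne_top.2 ⟨ENNReal.mul_ne_top ENNReal.ofReal_ne_top hvol,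
        ENNReal.mul_ne_top ENNReal.ofReal_ne_top (ENNReal.mul_ne_top (hBtop _ _) (hriesz _))⟩
    calc wspNorm s p Ω (fun x => vecMat (F x)) ≤ X (c₀ + 1) (C₃ M₀) := by
          refine wspNorm_le hs hp hsp hΩo.measurableSet (hR hΩb) hFm hFL fun h => ?_
          refine (hFt h).trans (mul_le_mul_left (nikolskiiConst_mono hθ0.le ?_) _)
          gcongr
          refine hweight.trans ?_
          gcongr
          exact hc_le c₀ ⟨k, j, hj, hMU, hc₀⟩
      _ = ENNReal.ofReal (X (c₀ + 1) (C₃ M₀)).toReal := (ENNReal.ofReal_toReal hX_top).symm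
      _ ≤ _ := ENNReal.ofReal_le_ofReal (by linarith)
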